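/- **Theorem 4.1.** Let $n\ge 2$ and $p\ge 0$ be integers, let $(N^{n+p},\bar g)$ be a Riemannian manifold of constant sectional curvature $\tilde c$, and let $M^n$ be an $n$-dimensional (immersed) submanifold of $N$ with the induced metric $g$. Let $h$ be its second fundamental form and, for a normal vector $\xi$, let $A_\xi$ be the shape operator, $g(A_\xi X,Y)=\bar g(h(X,Y),\xi)$. For $x\in M$ and orthonormal bases $e_1,\dots,e_n$ of $T_xM$, put $$\rho(x)=\frac{2}{n(n-1)}\sum_{i<j}K(e_i\wedge e_j),\qquad \mathcal C_x=\frac1n\sum_{i,j=1}^n\|h(e_i,e_j)\|^2 ,$$ where $K$ is the sectional curvature of $M$; for an $l$-dimensional subspace $L\subseteq T_xM$ with orthonormal basis $e_1,\dots,e_l$ put $\mathcal C(L)=\frac1l\sum_{i,j=1}^l\|h(e_i,e_j)\|^2$; and let $$[\delta_C(n-1)]_x=\tfrac12\,\mathcal C_x+\frac{n+1}{2n}\inf\{\mathcal C(L)\mid L\text{ a hyperplane of }T_xM\}.$$ Then at every point $x\in M$ $$\rho(x)\le[\delta_C(n-1)]_x+\tilde c .$$ Moreover, equality holds at $x$ if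 and only if all of the following hold at $x$: (i) $M$ is invariantly quasi-umbilical at $x$, i.e. there are an orthonormal basis $\xi_{n+1},\dots,\xi_{n+p}$ of the normal space and a unit vector $e\in T_xM$ such that each $A_{\xi_r}$ has $e$ as an eigenvector and is a multiple of the identity on the orthogonal complement of $e$ in $T_xM$; (ii) the normal connection is trivial at $x$, i.e. its curvature tensor $R^\perp$ vanishes at $x$; (iii) there are orthonormal bases $e_1,\dots,e_n$ of $T_xM$ and $e_{n+1},\dots,e_{n+p}$ of the normal space $T_x^\perp M$ and a real number $\lambda$ such that, with respect to $e_1,\dots,e_n$, $$A_{e_{n+1}}=\operatorname{diag}(\lambda,\dots,\lambda,2\lambda),\qquad A_{e_{n+2}}=\dots=A_{e_{n+p}}=0$$ (for $p=0$ the condition on the shape operators is void). In particular, equality holds at every point of $M$ if and only if (i)–(iii) hold at every point of $M$. -/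

import Mathlib

open scoped Manifold ContDiff Topology InnerProductSpace
open Bundle

noncomputable section

namespace Casorati

/-! ## Riemannian geometry in a coordinate domain

`G : F → F →L[ℝ] F →L[ℝ] ℝ` is the expression of a Riemannian metric in a chart, and `φ : E → F` is
the expression of a map between manifolds in charts. Vectors of the model space stand for the
coordinate vector fields with these constant components; any two of these commute. -/

section Chart

variable {E F : Type*} [NormedAddCommGroup E] [NormedSpace ℝ E]
  [NormedAddCommGroup F] [NormedSpace ℝ F]

/-- The Christoffel symbols (of the first kind) of the Levi-Civita connection: the linear form
`z ↦ (∂_v G(w, z) + ∂_w G(v, z) - ∂_z G(v, w)) / 2`. -/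
def christoffelFirst (G : F → F →L[ℝ] F →L[ℝ] ℝ) (u v w : F) : F →L[ℝ] ℝ :=
  (1 / 2 : ℝ) • (fderiv ℝ G u v w + fderiv ℝ G u w v - ((fderiv ℝ G u).flip v).flip w)

/-- The Christoffel symbols of the Levi-Civita connection: `christoffel G u v w = Γ_u(v, w)` is
the vector with `G u (Γ_u(v, w)) z = christoffelFirst G u v w z` for all `z`. -/
def christoffel (G : F → F →L[ℝ] F →L[ℝ] ℝ) (u v w : F) : F :=
  (G u).inverse (christoffelFirst G u v w)

/-- The Levi-Civita covariant derivative `∇_v V` at `u` of a vector field `V` along `φ`. For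
`φ = id` this is the Levi-Civita connection on vector fields. -/
def covDerivAlong (G : F → F →L[ℝ] F →L[ℝ] ℝ) (φ : E → F) (V : E → F) (u v : E) : F :=
  fderiv ℝ V u v + christoffel G (φ u) (fderiv ℝ φ u v) (V u)

/-- The Riemann curvature tensor `R(v, w)z = ∇_v ∇_w z - ∇_w ∇_v z` (coordinate fields commute). -/
def chartCurvature (G : F → F →L[ℝ] F →L[ℝ] ℝ) (u v w z : F) : F :=
  covDerivAlong G id (fun u' ↦ covDerivAlong G id (fun _ ↦ z) u' w) u v
    - covDerivAlong G id (fun u' ↦ covDerivAlong G id (fun _ ↦ z) u' v) u w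

/-- The second fundamental form `h(v, w) = ∇̄_v (dφ w) - dφ (∇_v w)` (Gauss formula), where `∇̄` is
the Levi-Civita connection of `G` and `∇` that of the metric `g` on the source. In coordinates:
`D²φ(v, w) + Γ̄(dφ v, dφ w) - dφ (Γ(v, w))`. -/
def chartSecondFundamentalForm (g : E → E →L[ℝ] E →L[ℝ] ℝ) (G : F → F →L[ℝ] F →L[ℝ] ℝ)
    (φ : E → F) (u v w : E) : F :=
  fderiv ℝ (fderiv ℝ φ) u v w + christoffel G (φ u) (fderiv ℝ φ u v) (fderiv ℝ φ u w)
    - fderiv ℝ φ u (christoffel g u v w)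

/-- The Gauss formula. -/
theorem chartSecondFundamentalForm_eq (g : E → E →L[ℝ] E →L[ℝ] ℝ) (G : F → F →L[ℝ] F →L[ℝ] ℝ)
    (φ : E → F) (u : E) (hφ : DifferentiableAt ℝ (fderiv ℝ φ) u) (v w : E) :
    chartSecondFundamentalForm g G φ u v w =
      covDerivAlong G φ (fun u' ↦ fderiv ℝ φ u' w) u v
        - fderiv ℝ φ u (covDerivAlong g id (fun _ ↦ w) u v) := by
  have h : fderiv ℝ (fun u' ↦ fderiv ℝ φ u' w) u v = fderiv ℝ (fderiv ℝ φ) u v w := by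
    rw [fderiv_clm_apply hφ (differentiableAt_const w)]
    simp
  simp [chartSecondFundamentalForm, covDerivAlong, h]

set_option synthInstance.maxHeartbeats 200000 in
theorem christoffel_add_left (G : F → F →L[ℝ] F →L[ℝ] ℝ) (u v v' w : F) :
    christoffel G u (v + v') w = christoffel G u v w + christoffel G u v' w := by
  rw [christoffel, christoffel, christoffel, ← map_add]
  congr 1
  ext z
  simp [christoffelFirst]
  ring

set_option synthInstance.maxHeartbeats 200000 in
theorem christoffel_smul_left (G : F → F →L[ℝ] F →L[ℝ] ℝ) (a : ℝ) (u v w : F) :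
    christoffel G u (a • v) w = a • christoffel G u v w := by
  rw [christoffel, christoffel, ← map_smul]
  congr 1
  ext z
  simp [christoffelFirst]
  ring

set_option synthInstance.maxHeartbeats 200000 in
theorem chartSecondFundamentalForm_add_left (g : E → E →L[ℝ] E →L[ℝ] ℝ)
    (G : F → F →L[ℝ] F →L[ℝ] ℝ) (φ : E → F) (u v v' w : E) :
    chartSecondFundamentalForm g G φ u (v + v') w =
      chartSecondFundamentalForm g G φ u v w + chartSecondFundamentalForm g G φ u v' w := by
  simp only [chartSecondFundamentalForm, map_add, christoffel_add_left, add_apply]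
  abel

set_option synthInstance.maxHeartbeats 200000 in
theorem chartSecondFundamentalForm_smul_left (g : E → E →L[ℝ] E →L[ℝ] ℝ)
    (G : F → F →L[ℝ] F →L[ℝ] ℝ) (φ : E → F) (a : ℝ) (u v w : E) :
    chartSecondFundamentalForm g G φ u (a • v) w =
      a • chartSecondFundamentalForm g G φ u v w := by
  simp only [chartSecondFundamentalForm, map_smul, christoffel_smul_left, smul_apply, smul_add,
    smul_sub]

/-- The normal part of `y` at `φ u`, for the isometric immersion `φ` from `g` to `G`: the vector
`y - dφ z` where `g u z = G (φ u) y (dφ ·)`. -/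
def chartNormalPart (g : E → E →L[ℝ] E →L[ℝ] ℝ) (G : F → F →L[ℝ] F →L[ℝ] ℝ)
    (φ : E → F) (u : E) (y : F) : F :=
  y - fderiv ℝ φ u ((g u).inverse ((G (φ u) y) ∘L fderiv ℝ φ u))

/-- The normal connection: `∇^⊥_v ξ` is the normal part of `∇̄_v ξ`. -/
def chartNormalDeriv (g : E → E →L[ℝ] E →L[ℝ] ℝ) (G : F → F →L[ℝ] F →L[ℝ] ℝ)
    (φ : E → F) (ξ : E → F) (u v : E) : F :=
  chartNormalPart g G φ u (covDerivAlong G φ ξ u v)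

/-- The curvature of the normal connection: `R^⊥(v, w)ξ = ∇^⊥_v ∇^⊥_w ξ - ∇^⊥_w ∇^⊥_v ξ`. -/
def chartNormalCurvature (g : E → E →L[ℝ] E →L[ℝ] ℝ) (G : F → F →L[ℝ] F →L[ℝ] ℝ)
    (φ : E → F) (ξ : E → F) (u v w : E) : F :=
  chartNormalDeriv g G φ (fun u' ↦ chartNormalDeriv g G φ ξ u' w) u v
    - chartNormalDeriv g G φ (fun u' ↦ chartNormalDeriv g G φ ξ u' v) u w

end Chart

/-! ## Riemannian manifolds

Mathlib's tangent space `T_x M` is the model space, read in the preferred chart at `x`; so the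
coordinate expressions in that chart at the point `x` are tensors on `T_x M`. -/

section Manifold

variable (m : ℕ) {M : Type*} [TopologicalSpace M] [ChartedSpace (EuclideanSpace ℝ (Fin m)) M]
  [RiemannianBundle (fun x : M ↦ TangentSpace (𝓡 m) x)]

instance instFiniteDimensionalTangentSpace (x : M) :
    FiniteDimensional ℝ (TangentSpace (𝓡 m) x) :=
  inferInstanceAs (FiniteDimensional ℝ (EuclideanSpace ℝ (Fin m)))

/-- The Riemannian metric of `M` in the preferred chart at `x`. -/
def chartMetric (x : M) (u : EuclideanSpace ℝ (Fin m)) :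
    EuclideanSpace ℝ (Fin m) →L[ℝ] EuclideanSpace ℝ (Fin m) →L[ℝ] ℝ :=
  (innerSL ℝ (E := TangentSpace (𝓡 m) ((extChartAt (𝓡 m) x).symm u))).bilinearComp
    (mfderiv 𝓘(ℝ, EuclideanSpace ℝ (Fin m)) (𝓡 m) (extChartAt (𝓡 m) x).symm u)
    (mfderiv 𝓘(ℝ, EuclideanSpace ℝ (Fin m)) (𝓡 m) (extChartAt (𝓡 m) x).symm u)

/-- The Riemann curvature tensor `R(v, w)z` of `M` at `x`. -/
def curvatureTensor (x : M) (v w z : TangentSpace (𝓡 m) x) : TangentSpace (𝓡 m) x :=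
  chartCurvature (F := EuclideanSpace ℝ (Fin m)) (chartMetric m x) (extChartAt (𝓡 m) x x) v w z

/-- The sectional curvature of the plane spanned by `v` and `w`. -/
def sectionalCurvature (x : M) (v w : TangentSpace (𝓡 m) x) : ℝ :=
  ⟪curvatureTensor m x v w w, v⟫_ℝ / (‖v‖ ^ 2 * ‖w‖ ^ 2 - ⟪v, w⟫_ℝ ^ 2)

/-- The scalar curvature `τ = ∑_{i < j} K(e_i ∧ e_j)`, with `e` an orthonormal basis of `T_x M`. -/
def scalarCurvature (x : M) : ℝ :=
  let e := stdOrthonormalBasis ℝ (TangentSpace (𝓡 m) x)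
  ∑ i, ∑ j, if i < j then sectionalCurvature m x (e i) (e j) else 0

/-- The normalized scalar curvature `ρ = 2τ / (m (m - 1))` of an `m`-dimensional manifold. -/
def normalizedScalarCurvature (x : M) : ℝ :=
  2 * scalarCurvature m x / ((m : ℝ) * ((m : ℝ) - 1))

variable (M) in
/-- All sectional curvatures of `M` are equal to `c`. -/
def HasConstantSectionalCurvature (c : ℝ) : Prop :=
  ∀ (x : M) (v w : TangentSpace (𝓡 m) x), LinearIndependent ℝ ![v, w] →
    sectionalCurvature m x v w = c

end Manifold

/-! ## Submanifolds -/

section Submanifold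

variable (n k : ℕ)
  {M : Type*} [TopologicalSpace M] [ChartedSpace (EuclideanSpace ℝ (Fin n)) M]
  [RiemannianBundle (fun x : M ↦ TangentSpace (𝓡 n) x)]
  {N : Type*} [TopologicalSpace N] [ChartedSpace (EuclideanSpace ℝ (Fin k)) N]
  [RiemannianBundle (fun y : N ↦ TangentSpace (𝓡 k) y)]

/-- `f : M → N` is a smooth isometric immersion: the metric of `M` is induced by that of `N`
(so the differentials of `f` are injective). -/
def IsIsometricImmersion (f : M → N) : Prop :=
  ContMDiff (𝓡 n) (𝓡 k) ∞ f ∧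
    ∀ (x : M) (v w : TangentSpace (𝓡 n) x),
      ⟪mfderiv (𝓡 n) (𝓡 k) f x v, mfderiv (𝓡 n) (𝓡 k) f x w⟫_ℝ = ⟪v, w⟫_ℝ

/-- The normal space `T_x^⊥ M` inside `T_{f x} N`. -/
def normalSpace (f : M → N) (x : M) : Submodule ℝ (TangentSpace (𝓡 k) (f x)) :=
  (LinearMap.range (mfderiv (𝓡 n) (𝓡 k) f x : TangentSpace (𝓡 n) x →ₗ[ℝ] _))ᗮ

/-- The second fundamental form `h(v, w)` at `x`. -/
def secondFundamentalForm (f : M → N) (x : M) (v w : TangentSpace (𝓡 n) x) :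
    TangentSpace (𝓡 k) (f x) :=
  chartSecondFundamentalForm (E := EuclideanSpace ℝ (Fin n)) (F := EuclideanSpace ℝ (Fin k))
    (chartMetric n x) (chartMetric k (f x))
    (writtenInExtChartAt (𝓡 n) (𝓡 k) x f) (extChartAt (𝓡 n) x x) v w

/-- The shape operator `A_ξ` at `x`: the linear map with `⟪A_ξ v, w⟫ = ⟪h(v, w), ξ⟫`, that is,
`A_ξ v = ∑ i, ⟪h(v, e_i), ξ⟫ e_i` with `e` an orthonormal basis of `T_x M`. -/
def shapeOperator (f : M → N) (x : M) (ξ : TangentSpace (𝓡 k) (f x)) :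
    TangentSpace (𝓡 n) x →ₗ[ℝ] TangentSpace (𝓡 n) x where
  toFun v :=
    let e := stdOrthonormalBasis ℝ (TangentSpace (𝓡 n) x)
    ∑ i, ⟪secondFundamentalForm n k f x v (e i), ξ⟫_ℝ • e i
  map_add' v w := by
    have h (z : TangentSpace (𝓡 n) x) : secondFundamentalForm n k f x (v + w) z =
        secondFundamentalForm n k f x v z + secondFundamentalForm n k f x w z :=
      chartSecondFundamentalForm_add_left (E := EuclideanSpace ℝ (Fin n))
        (F := EuclideanSpace ℝ (Fin k)) _ _ _ _ _ _ _
    simp only [h, inner_add_left, add_smul, Finset.sum_add_distrib]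
  map_smul' a v := by
    have h (z : TangentSpace (𝓡 n) x) : secondFundamentalForm n k f x (a • v) z =
        a • secondFundamentalForm n k f x v z :=
      chartSecondFundamentalForm_smul_left (E := EuclideanSpace ℝ (Fin n))
        (F := EuclideanSpace ℝ (Fin k)) _ _ _ _ _ _ _
    simp only [h, inner_smul_left, mul_smul, Finset.smul_sum, RingHom.id_apply, conj_trivial]

/-- The Casorati curvature `C = (1/n) ∑_{i,j} ‖h(e_i, e_j)‖²`, with `e` an orthonormal basis of
`T_x M`. -/
def casoratiCurvature (f : M → N) (x : M) : ℝ :=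
  let e := stdOrthonormalBasis ℝ (TangentSpace (𝓡 n) x)
  (1 / (n : ℝ)) * ∑ i, ∑ j, ‖secondFundamentalForm n k f x (e i) (e j)‖ ^ 2

/-- The Casorati curvature `C(L) = (1/l) ∑_{i,j} ‖h(e_i, e_j)‖²` of an `l`-dimensional subspace `L`
of `T_x M`, with `e` an orthonormal basis of `L`. -/
def casoratiCurvatureOf (f : M → N) (x : M) (L : Submodule ℝ (TangentSpace (𝓡 n) x)) : ℝ :=
  let e := stdOrthonormalBasis ℝ L
  (1 / (Module.finrank ℝ L : ℝ)) *
    ∑ i, ∑ j, ‖secondFundamentalForm n k f x (e i : TangentSpace (𝓡 n) x) (e j)‖ ^ 2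

/-- The normalized `δ`-Casorati curvature
`δ_C(n-1) = C/2 + (n+1)/(2n) · inf {C(L) | L a hyperplane of T_x M}`. -/
def deltaCasorati (f : M → N) (x : M) : ℝ :=
  (1 / 2) * casoratiCurvature n k f x + ((n : ℝ) + 1) / (2 * (n : ℝ)) *
    sInf {c : ℝ | ∃ L : Submodule ℝ (TangentSpace (𝓡 n) x),
      Module.finrank ℝ L + 1 = n ∧ c = casoratiCurvatureOf n k f x L}

/-- `M` is invariantly quasi-umbilical at `x`: there are an orthonormal basis `ξ` of the normal
space (`k = n + p`) and a common unit vector `e` such that every shape operator `A_{ξ_r}` has `e` as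
an eigenvector and acts on the hyperplane orthogonal to `e` as a scalar. -/
def IsInvariantlyQuasiUmbilicalAt (p : ℕ) (f : M → N) (x : M) : Prop :=
  ∃ (ξ : OrthonormalBasis (Fin p) ℝ (normalSpace n k f x)) (e : TangentSpace (𝓡 n) x), ‖e‖ = 1 ∧
    ∀ r : Fin p, ∃ a b : ℝ,
      shapeOperator n k f x (ξ r : TangentSpace (𝓡 k) (f x)) e = b • e ∧
      ∀ v : TangentSpace (𝓡 n) x, ⟪v, e⟫_ℝ = 0 →
        shapeOperator n k f x (ξ r : TangentSpace (𝓡 k) (f x)) v = a • v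

/-- The normal connection is trivial (flat) at `x`: the normal curvature tensor vanishes at `x`,
i.e. `R^⊥(v, w)ξ = 0` at `x` for all smooth normal fields `ξ` near `x`. -/
def HasTrivialNormalConnectionAt (f : M → N) (x : M) : Prop :=
  let φ := writtenInExtChartAt (𝓡 n) (𝓡 k) x f
  let u := extChartAt (𝓡 n) x x
  ∀ ξ : EuclideanSpace ℝ (Fin n) → EuclideanSpace ℝ (Fin k), ContDiffAt ℝ ∞ ξ u →
    (∀ᶠ u' in 𝓝 u, ∀ z, chartMetric k (f x) (φ u') (ξ u') (fderiv ℝ φ u' z) = 0) →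
    ∀ v w, chartNormalCurvature (chartMetric n x) (chartMetric k (f x)) φ ξ u v w = 0

end Submanifold

end Casorati

end

/-! Write `n = l + 1`, `H = ∑ h(e_i, e_i)`, `S = ∑ ‖h(e_i, e_j)‖²`, and `S_L` for the analogous
double sum over a hyperplane `L`. In a space of constant curvature `c` the Gauss equation gives `ρ -
c = (‖H‖² - S) / (n (n - 1))`. The excess of the right side of the inequality over the left is
therefore a positive multiple of `Q = S + S_L - 2 / (l + 2) * ‖H‖²`, where `L` minimises `S_L`.

Take an orthonormal basis whose last vector is normal to `L`, and put `Λ = H / (l + 2)`. Completing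
squares (`casorati_identity`) turns `Q` into a sum of squares: the distances of `h(e_i, e_j)` from
`Λ` or `0` inside `L`, the mixed terms, and `‖h(e_n, e_n) - 2Λ‖²`. So `Q ≥ 0`, and `Q = 0` exactly
when `h` is diagonal with entries `Λ, …, Λ, 2Λ`. The minimum over `L` exists because `S_L` is a
continuous function of the unit normal of `L`; hence the equality case of the infimum can be read
off at one hyperplane, and conversely a hyperplane with vanishing remainder must be minimal
(`casorati_inequality`).

Choosing the first normal frame vector along `Λ` rewrites this diagonal form as condition (iii).
Conditions (i) and (ii) then follow: the last tangent vector is the distinguished direction, and by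
the Ricci equation `R^⊥` is the normal part of the ambient curvature, which is zero in constant
curvature, plus a commutator of shape operators, which is zero as they are simultaneously diagonal.

The geometric input (Gauss and Ricci equations, curvature symmetries) is derived in charts, from
metric compatibility and vanishing torsion of the connection along a map. Constant sectional
curvature determines the ambient tensor through the algebraic lemma `curvatureLike_eq_zero`. -/

noncomputable section

namespace Casorati

/-! ### Levi-Civita connection and curvature symmetries in a chart -/

section ChartMetric

set_option maxSynthPendingDepth 3
set_option synthInstance.maxHeartbeats 200000

variable {E F : Type*} [NormedAddCommGroup E] [NormedSpace ℝ E]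
  [NormedAddCommGroup F] [NormedSpace ℝ F]

/-- `G` is a symmetric nondegenerate bilinear form depending on a point in a `C³` way near `y`. -/
structure IsChartMetricAt (G : F → F →L[ℝ] F →L[ℝ] ℝ) (y : F) : Prop where
  contDiffAt : ContDiffAt ℝ 3 G y
  symm : ∀ y v w, G y v w = G y w v
  isInvertible : (G y).IsInvertible

variable {G : F → F →L[ℝ] F →L[ℝ] ℝ} {y : F}

/-- The conditions are open. This is needed because the curvature identities come from
differentiating first-order identities, which must hold on a neighbourhood. -/
theorem IsChartMetricAt.eventually [CompleteSpace F] (hG : IsChartMetricAt G y) :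
    ∀ᶠ y' in 𝓝 y, IsChartMetricAt G y' := by
  have h1 := hG.contDiffAt.eventually (by decide)
  have h2 : ∀ᶠ y' in 𝓝 y, (G y').IsInvertible := by
    apply hG.contDiffAt.continuousAt.eventually
    exact ContinuousLinearEquiv.isOpen.mem_nhds hG.isInvertible
  filter_upwards [h1, h2] with y' h3 h4
  exact ⟨h3, hG.symm, h4⟩

theorem IsChartMetricAt.differentiableAt (hG : IsChartMetricAt G y) : DifferentiableAt ℝ G y :=
  hG.contDiffAt.differentiableAt (by norm_num)

theorem IsChartMetricAt.fderiv_symm (hG : IsChartMetricAt G y) (a v w : F) :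
    fderiv ℝ G y a v w = fderiv ℝ G y a w v := by
  have key : ∀ v w, fderiv ℝ G y a v w = fderiv ℝ (fun y ↦ G y v w) y a := by
    intro v w
    have := ((hG.differentiableAt.hasFDerivAt.clm_apply (hasFDerivAt_const v y)).clm_apply
      (hasFDerivAt_const w y)).fderiv
    rw [this]; simp
  rw [key, key]
  simp only [hG.symm _ v w]

theorem IsChartMetricAt.christoffelFirst_symm (hG : IsChartMetricAt G y) (v w : F) :
    christoffelFirst G y v w = christoffelFirst G y w v := by
  ext z
  simp only [christoffelFirst, smul_apply, sub_apply,
    add_apply, ContinuousLinearMap.flip_apply]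
  rw [hG.fderiv_symm z v w]; ring_nf

theorem IsChartMetricAt.christoffel_symm (hG : IsChartMetricAt G y) (v w : F) :
    christoffel G y v w = christoffel G y w v := by
  rw [christoffel, christoffel, hG.christoffelFirst_symm]

theorem IsChartMetricAt.apply_christoffel (hG : IsChartMetricAt G y) (v w z : F) :
    G y (christoffel G y v w) z = christoffelFirst G y v w z := by
  rw [christoffel, hG.isInvertible.self_apply_inverse]

theorem IsChartMetricAt.ext (hG : IsChartMetricAt G y) {a b : F} (h : ∀ z, G y a z = G y b z) :
    a = b :=
  hG.isInvertible.injective (by ext z; exact h z)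

/-- The Christoffel symbols as a continuous bilinear map. -/
def christoffelCLM (G : F → F →L[ℝ] F →L[ℝ] ℝ) (y : F) : F →L[ℝ] F →L[ℝ] F :=
  (ContinuousLinearMap.compL ℝ F (F →L[ℝ] ℝ) F (G y).inverse) ∘L
    ((1 / 2 : ℝ) • (fderiv ℝ G y + (fderiv ℝ G y).flip
      - ((ContinuousLinearMap.flipₗᵢ ℝ F F ℝ).toContinuousLinearEquiv :
        (F →L[ℝ] F →L[ℝ] ℝ) →L[ℝ] (F →L[ℝ] F →L[ℝ] ℝ)) ∘L (fderiv ℝ G y).flip))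

theorem christoffelCLM_apply (G : F → F →L[ℝ] F →L[ℝ] ℝ) (y v w : F) :
    christoffelCLM G y v w = christoffel G y v w := by
  rw [christoffel]
  simp only [christoffelCLM, ContinuousLinearMap.comp_apply, ContinuousLinearMap.compL_apply]
  congr 1

theorem IsChartMetricAt.contDiffAt_christoffelCLM [CompleteSpace F] (hG : IsChartMetricAt G y) :
    ContDiffAt ℝ 2 (christoffelCLM G) y := by
  have h1 : ContDiffAt ℝ 2 (fderiv ℝ G) y := hG.contDiffAt.fderiv_right (by norm_num)
  have h2 : ContDiffAt ℝ 2 (fun y ↦ (fderiv ℝ G y).flip) y :=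
    (ContinuousLinearMap.flipₗᵢ ℝ F F (F →L[ℝ] ℝ)).contDiff.contDiffAt.comp y h1
  have h3 : ContDiffAt ℝ 2 (fun y ↦ (G y).inverse) y :=
    (hG.isInvertible.contDiffAt_map_inverse (n := 2)).comp y (hG.contDiffAt.of_le (by norm_num))
  unfold christoffelCLM
  refine ContDiffAt.clm_comp (h3.continuousLinearMap_comp
    (ContinuousLinearMap.compL ℝ F (F →L[ℝ] ℝ) F)) ?_
  exact ((h1.add h2).sub (contDiffAt_const.clm_comp h2)).const_smul _

theorem covDerivAlong_eq (G : F → F →L[ℝ] F →L[ℝ] ℝ) (φ V : E → F) (u v : E) :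
    covDerivAlong G φ V u v =
      fderiv ℝ V u v + christoffelCLM G (φ u) (fderiv ℝ φ u v) (V u) := by
  rw [covDerivAlong, christoffelCLM_apply]

theorem contDiffAt_covDerivAlong [CompleteSpace F] {φ V : E → F} {u : E}
    (hG : IsChartMetricAt G (φ u)) (hφ : ContDiffAt ℝ 3 φ u) (hV : ContDiffAt ℝ 2 V u) (v : E) :
    ContDiffAt ℝ 1 (fun u' ↦ covDerivAlong G φ V u' v) u := by
  simp only [covDerivAlong_eq]
  have h1 : ContDiffAt ℝ 1 (fderiv ℝ V) u := hV.fderiv_right (by norm_num)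
  have h2 : ContDiffAt ℝ 1 (fderiv ℝ φ) u := hφ.fderiv_right (by norm_num)
  have h3 : ContDiffAt ℝ 1 (fun u ↦ christoffelCLM G (φ u)) u :=
    (hG.contDiffAt_christoffelCLM.of_le (by norm_num)).comp u (hφ.of_le (by norm_num))
  exact (h1.clm_apply contDiffAt_const).add
    ((h3.clm_apply (h2.clm_apply contDiffAt_const)).clm_apply (hV.of_le (by norm_num)))

/-- The Levi-Civita connection is compatible with the metric. -/
theorem fderiv_metric_apply {φ V W : E → F} {u : E} (hG : IsChartMetricAt G (φ u))
    (hφ : DifferentiableAt ℝ φ u) (hV : DifferentiableAt ℝ V u) (hW : DifferentiableAt ℝ W u)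
    (v : E) :
    fderiv ℝ (fun u' ↦ G (φ u') (V u') (W u')) u v =
      G (φ u) (covDerivAlong G φ V u v) (W u) + G (φ u) (V u) (covDerivAlong G φ W u v) := by
  have h1 : HasFDerivAt (fun u' ↦ G (φ u')) _ u :=
    hG.differentiableAt.hasFDerivAt.comp u hφ.hasFDerivAt
  rw [((h1.clm_apply hV.hasFDerivAt).clm_apply hW.hasFDerivAt).fderiv]
  simp only [covDerivAlong, map_add, add_apply, hG.apply_christoffel,
    hG.symm (φ u) (V u) (christoffel _ _ _ _)]
  simp only [christoffelFirst, smul_apply, sub_apply, smul_eq_mul,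
    add_apply, ContinuousLinearMap.flip_apply, ContinuousLinearMap.comp_apply]
  -- In the two Christoffel terms the derivatives of `G` in the directions `V` and `W` cancel by
  -- symmetry, and the two halves of the derivative along `dφ v` add up.
  rw [hG.fderiv_symm _ (W u) (V u), hG.fderiv_symm (V u) _ (W u), hG.fderiv_symm (W u) _ (V u)]
  ring

theorem fderiv_fderiv_apply {φ : E → F} {u : E} (hφ : DifferentiableAt ℝ (fderiv ℝ φ) u)
    (v w : E) : fderiv ℝ (fun u' ↦ fderiv ℝ φ u' w) u v = fderiv ℝ (fderiv ℝ φ) u v w := by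
  rw [fderiv_clm_apply hφ (differentiableAt_const w)]
  simp

theorem fderiv_fderiv_symm {φ : E → F} {u : E} (hφ : ContDiffAt ℝ 2 φ u) (v w : E) :
    fderiv ℝ (fderiv ℝ φ) u v w = fderiv ℝ (fderiv ℝ φ) u w v :=
  hφ.isSymmSndFDerivAt (by simp) v w

/-- The Levi-Civita connection is torsion-free. -/
theorem covDerivAlong_fderiv_symm {φ : E → F} {u : E} (hG : IsChartMetricAt G (φ u))
    (hφ : ContDiffAt ℝ 2 φ u) (v w : E) :
    covDerivAlong G φ (fun u' ↦ fderiv ℝ φ u' w) u v =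
      covDerivAlong G φ (fun u' ↦ fderiv ℝ φ u' v) u w := by
  have h : DifferentiableAt ℝ (fderiv ℝ φ) u :=
    (hφ.fderiv_right (m := 1) (by norm_num)).differentiableAt (by norm_num)
  rw [covDerivAlong, covDerivAlong, fderiv_fderiv_apply h, fderiv_fderiv_apply h,
    fderiv_fderiv_symm hφ, hG.christoffel_symm]

theorem covDerivAlong_congr {φ V W : E → F} {u : E} (h : V =ᶠ[𝓝 u] W) (v : E) :
    covDerivAlong G φ V u v = covDerivAlong G φ W u v := by
  rw [covDerivAlong, covDerivAlong, h.fderiv_eq, h.eq_of_nhds]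

/-- The terms are grouped for antisymmetrisation: the last bracket is symmetric in `v` and `w`, so
only the first two terms survive in a commutator, and these involve `V` only through its value at
`u`. -/
theorem covDerivAlong_covDerivAlong [CompleteSpace F] {φ V : E → F} {u : E}
    (hG : IsChartMetricAt G (φ u)) (hφ : ContDiffAt ℝ 3 φ u) (hV : ContDiffAt ℝ 2 V u) (v w : E) :
    covDerivAlong G φ (fun u' ↦ covDerivAlong G φ V u' w) u v =
      fderiv ℝ (christoffelCLM G) (φ u) (fderiv ℝ φ u v) (fderiv ℝ φ u w) (V u)
      + christoffelCLM G (φ u) (fderiv ℝ φ u v) (christoffelCLM G (φ u) (fderiv ℝ φ u w) (V u))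
      + (fderiv ℝ (fderiv ℝ V) u v w
        + christoffelCLM G (φ u) (fderiv ℝ (fderiv ℝ φ) u v w) (V u)
        + (christoffelCLM G (φ u) (fderiv ℝ φ u w) (fderiv ℝ V u v)
          + christoffelCLM G (φ u) (fderiv ℝ φ u v) (fderiv ℝ V u w))) := by
  have h1 : DifferentiableAt ℝ (fderiv ℝ V) u :=
    (hV.fderiv_right (m := 1) (by norm_num)).differentiableAt (by norm_num)
  have h2 : DifferentiableAt ℝ (fderiv ℝ φ) u :=
    (hφ.fderiv_right (m := 1) (by norm_num)).differentiableAt (by norm_num)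
  have h3 : HasFDerivAt (fun u' ↦ christoffelCLM G (φ u')) _ u :=
    (hG.contDiffAt_christoffelCLM.differentiableAt (by norm_num)).hasFDerivAt.comp u
      (hφ.differentiableAt (by norm_num)).hasFDerivAt
  rw [covDerivAlong_eq]
  simp only [covDerivAlong_eq]
  rw [((h1.hasFDerivAt.clm_apply (hasFDerivAt_const w u)).fun_add
    ((h3.clm_apply (h2.hasFDerivAt.clm_apply (hasFDerivAt_const w u))).clm_apply
      (hV.differentiableAt (by norm_num)).hasFDerivAt)).fderiv]
  simp only [map_add, add_apply, ContinuousLinearMap.comp_apply, ContinuousLinearMap.flip_apply,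
    zero_apply, map_zero, zero_add]
  abel

theorem chartCurvature_eq [CompleteSpace F] (hG : IsChartMetricAt G y) (v w z : F) :
    chartCurvature G y v w z =
      fderiv ℝ (christoffelCLM G) y v w z + christoffelCLM G y v (christoffelCLM G y w z)
      - (fderiv ℝ (christoffelCLM G) y w v z
        + christoffelCLM G y w (christoffelCLM G y v z)) := by
  have h (v w : F) := covDerivAlong_covDerivAlong (φ := id) (V := fun _ : F ↦ z) (u := y) hG
    contDiffAt_id contDiffAt_const v w
  have h' : fderiv ℝ (fderiv ℝ (id : F → F)) y = 0 := by
    have : fderiv ℝ (id : F → F) = fun _ ↦ ContinuousLinearMap.id ℝ F := by ext1 x; exact fderiv_id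
    rw [this]; simp
  have h'' : fderiv ℝ (fun _ : F ↦ z) = fun _ ↦ 0 := by ext1 x; simp
  rw [chartCurvature, h v w, h w v, h', h'']
  simp

/-- The curvature of the pulled back connection. -/
theorem covDerivAlong_commutator [CompleteSpace F] {φ V : E → F} {u : E}
    (hG : IsChartMetricAt G (φ u)) (hφ : ContDiffAt ℝ 3 φ u) (hV : ContDiffAt ℝ 2 V u) (v w : E) :
    covDerivAlong G φ (fun u' ↦ covDerivAlong G φ V u' w) u v
      - covDerivAlong G φ (fun u' ↦ covDerivAlong G φ V u' v) u w =
      chartCurvature G (φ u) (fderiv ℝ φ u v) (fderiv ℝ φ u w) (V u) := by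
  rw [covDerivAlong_covDerivAlong hG hφ hV, covDerivAlong_covDerivAlong hG hφ hV,
    chartCurvature_eq hG, fderiv_fderiv_symm hV,
    fderiv_fderiv_symm (hφ.of_le (by norm_num : (2 : WithTop ℕ∞) ≤ 3))]
  abel

/-- The first Bianchi identity. -/
theorem chartCurvature_bianchi [CompleteSpace F] (hG : IsChartMetricAt G y) (v w z : F) :
    chartCurvature G y v w z + chartCurvature G y w z v + chartCurvature G y z v w = 0 := by
  -- Vanishing torsion gives `∇_w z = ∇_z w` for constant fields on a whole neighbourhood, so the
  -- six second derivatives cancel in pairs.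
  have h (v w z : F) :
      covDerivAlong G id (fun y' ↦ covDerivAlong G id (fun _ ↦ z) y' w) y v =
      covDerivAlong G id (fun y' ↦ covDerivAlong G id (fun _ ↦ w) y' z) y v := by
    apply covDerivAlong_congr
    filter_upwards [hG.eventually] with y' hy'
    simp only [covDerivAlong, fderiv_id, fderiv_fun_const]
    simp [hy'.christoffel_symm w z]
  simp only [chartCurvature]
  rw [h v w z, h w z v, h z v w]
  abel

theorem chartCurvature_swap (G : F → F →L[ℝ] F →L[ℝ] ℝ) (y v w z : F) :
    chartCurvature G y v w z = - chartCurvature G y w v z := by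
  simp [chartCurvature]

/-- Second derivatives of the function `G(z, z')` commute. Expanding both orders by metric
compatibility, the products of first covariant derivatives are symmetric in `v, w` and drop out,
leaving the skew-symmetry. -/
theorem chartCurvature_skew [CompleteSpace F] (hG : IsChartMetricAt G y) (v w z z' : F) :
    G y (chartCurvature G y v w z) z' = - G y (chartCurvature G y v w z') z := by
  set D : F → F → F → F := fun z w y' ↦ covDerivAlong G id (fun _ ↦ z) y' w with hD
  have hD1 (z w : F) : DifferentiableAt ℝ (D z w) y :=
    (contDiffAt_covDerivAlong (φ := id) hG contDiffAt_id contDiffAt_const w).differentiableAt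
      (by norm_num)
  have h1 (v w : F) : fderiv ℝ (fderiv ℝ (fun y' ↦ G y' z z')) y v w =
      G y (covDerivAlong G id (D z w) y v) z' + G y (D z w y) (D z' v y)
      + (G y (D z v y) (D z' w y) + G y z (covDerivAlong G id (D z' w) y v)) := by
    have hs : ContDiffAt ℝ 3 (fun y' ↦ G y' z z') y :=
      (hG.contDiffAt.clm_apply contDiffAt_const).clm_apply contDiffAt_const
    rw [← fderiv_fderiv_apply
      ((hs.fderiv_right (m := 1) (by norm_num)).differentiableAt (by norm_num))]
    have he : (fun y' ↦ fderiv ℝ (fun y' ↦ G y' z z') y' w) =ᶠ[𝓝 y]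
        fun y' ↦ G (id y') (D z w y') z' + G (id y') z (D z' w y') := by
      filter_upwards [hG.eventually] with y' hy'
      exact fderiv_metric_apply (φ := id) hy' differentiableAt_id (differentiableAt_const z)
        (differentiableAt_const z') w
    rw [he.fderiv_eq, fderiv_fun_add, add_apply,
      fderiv_metric_apply (φ := id) hG differentiableAt_id (hD1 z w) (differentiableAt_const z'),
      fderiv_metric_apply (φ := id) hG differentiableAt_id (differentiableAt_const z) (hD1 z' w)]
    · rfl
    · exact (hG.differentiableAt.clm_apply (hD1 z w)).clm_apply (differentiableAt_const z')
    · exact (hG.differentiableAt.clm_apply (differentiableAt_const z)).clm_apply (hD1 z' w)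
  have hs : ContDiffAt ℝ 2 (fun y' ↦ G y' z z') y :=
    ((hG.contDiffAt.clm_apply contDiffAt_const).clm_apply contDiffAt_const).of_le (by norm_num)
  have h2 := fderiv_fderiv_symm hs v w
  rw [h1 v w, h1 w v] at h2
  rw [hG.symm y (chartCurvature G y v w z')]
  simp only [chartCurvature, map_sub, sub_apply]
  change G y (covDerivAlong G id (D z w) y v) z' - G y (covDerivAlong G id (D z v) y w) z' =
    -(G y z (covDerivAlong G id (D z' w) y v) - G y z (covDerivAlong G id (D z' v) y w))
  linarith

end ChartMetric

/-! ### Isometric immersions in charts: Gauss, Weingarten and Ricci -/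

section ChartImmersion

set_option maxSynthPendingDepth 3
set_option synthInstance.maxHeartbeats 200000

variable {E F : Type*} [NormedAddCommGroup E] [NormedSpace ℝ E]
  [NormedAddCommGroup F] [NormedSpace ℝ F]

/-- `φ` is a `C³` isometric immersion near `u`, from the metric `g` to the metric `G`. -/
structure IsChartIsometricAt (g : E → E →L[ℝ] E →L[ℝ] ℝ) (G : F → F →L[ℝ] F →L[ℝ] ℝ)
    (φ : E → F) (u : E) : Prop where
  source : IsChartMetricAt g u
  target : IsChartMetricAt G (φ u)
  contDiffAt : ContDiffAt ℝ 3 φ u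
  isometric : ∀ᶠ u' in 𝓝 u, ∀ v w, G (φ u') (fderiv ℝ φ u' v) (fderiv ℝ φ u' w) = g u' v w

variable {g : E → E →L[ℝ] E →L[ℝ] ℝ} {G : F → F →L[ℝ] F →L[ℝ] ℝ} {φ : E → F} {u : E}

theorem IsChartIsometricAt.eventually [CompleteSpace E] [CompleteSpace F]
    (h : IsChartIsometricAt g G φ u) : ∀ᶠ u' in 𝓝 u, IsChartIsometricAt g G φ u' := by
  filter_upwards [h.source.eventually, h.contDiffAt.continuousAt.eventually h.target.eventually,
    h.contDiffAt.eventually (by decide), h.isometric.eventually_nhds] with u' h1 h2 h3 h4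
  exact ⟨h1, h2, h3, h4⟩

theorem IsChartIsometricAt.contDiffAt_fderiv_apply (h : IsChartIsometricAt g G φ u) (w : E) :
    ContDiffAt ℝ 2 (fun u' ↦ fderiv ℝ φ u' w) u :=
  (h.contDiffAt.fderiv_right (by norm_num)).clm_apply contDiffAt_const

theorem IsChartIsometricAt.differentiableAt_fderiv (h : IsChartIsometricAt g G φ u) :
    DifferentiableAt ℝ (fderiv ℝ φ) u :=
  (h.contDiffAt.fderiv_right (m := 1) (by norm_num)).differentiableAt (by norm_num)

/-- The Koszul argument: differentiate `g = φ^*G` in three directions by metric compatibility and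
combine using vanishing torsion. It identifies the tangential part of `∇̄` with the connection of
`g`. -/
theorem IsChartIsometricAt.metric_covDerivAlong_fderiv (h : IsChartIsometricAt g G φ u)
    (v w z : E) :
    G (φ u) (covDerivAlong G φ (fun u' ↦ fderiv ℝ φ u' w) u v) (fderiv ℝ φ u z) =
      christoffelFirst g u v w z := by
  have hd (w : E) : DifferentiableAt ℝ (fun u' ↦ fderiv ℝ φ u' w) u :=
    (h.contDiffAt_fderiv_apply w).differentiableAt (by norm_num)
  have key (v w z : E) : fderiv ℝ g u v w z =
      G (φ u) (covDerivAlong G φ (fun u' ↦ fderiv ℝ φ u' w) u v) (fderiv ℝ φ u z)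
      + G (φ u) (covDerivAlong G φ (fun u' ↦ fderiv ℝ φ u' z) u v) (fderiv ℝ φ u w) := by
    have h1 : fderiv ℝ (fun u' ↦ g u' w z) u v = fderiv ℝ g u v w z := by
      rw [((h.source.differentiableAt.hasFDerivAt.clm_apply (hasFDerivAt_const w u)).clm_apply
        (hasFDerivAt_const z u)).fderiv]
      simp
    have h2 : (fun u' ↦ g u' w z) =ᶠ[𝓝 u]
        fun u' ↦ G (φ u') (fderiv ℝ φ u' w) (fderiv ℝ φ u' z) := by
      filter_upwards [h.isometric] with u' hu'
      rw [hu']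
    rw [← h1, h2.fderiv_eq, fderiv_metric_apply h.target
      (h.contDiffAt.differentiableAt (by norm_num)) (hd w) (hd z),
      h.target.symm _ (fderiv ℝ φ u w)]
  have hs (v w : E) := covDerivAlong_fderiv_symm h.target
    (h.contDiffAt.of_le (by norm_num : (2 : WithTop ℕ∞) ≤ 3)) v w
  simp only [christoffelFirst, smul_apply, sub_apply, smul_eq_mul, add_apply,
    ContinuousLinearMap.flip_apply]
  rw [key v w z, key w v z, key z v w, hs w v, hs z v, hs z w]
  ring

theorem IsChartIsometricAt.covDerivAlong_fderiv_eq (h : IsChartIsometricAt g G φ u) (v w : E) :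
    covDerivAlong G φ (fun u' ↦ fderiv ℝ φ u' w) u v =
      fderiv ℝ φ u (covDerivAlong g id (fun _ ↦ w) u v)
        + chartSecondFundamentalForm g G φ u v w := by
  rw [chartSecondFundamentalForm_eq g G φ u h.differentiableAt_fderiv]
  abel

theorem IsChartIsometricAt.metric_fderiv (h : IsChartIsometricAt g G φ u) (v w : E) :
    G (φ u) (fderiv ℝ φ u v) (fderiv ℝ φ u w) = g u v w :=
  h.isometric.self_of_nhds v w

theorem covDerivAlong_id_const (g : E → E →L[ℝ] E →L[ℝ] ℝ) (u v w : E) :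
    covDerivAlong g id (fun _ ↦ w) u v = christoffel g u v w := by
  simp [covDerivAlong, fderiv_id]

/-- The second fundamental form takes normal values. -/
theorem IsChartIsometricAt.metric_secondFundamentalForm_fderiv (h : IsChartIsometricAt g G φ u)
    (v w z : E) :
    G (φ u) (chartSecondFundamentalForm g G φ u v w) (fderiv ℝ φ u z) = 0 := by
  rw [chartSecondFundamentalForm_eq g G φ u h.differentiableAt_fderiv, map_sub, sub_apply,
    h.metric_covDerivAlong_fderiv, h.metric_fderiv, covDerivAlong_id_const,
    h.source.apply_christoffel, sub_self]

theorem IsChartIsometricAt.secondFundamentalForm_symm (h : IsChartIsometricAt g G φ u)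
    (v w : E) :
    chartSecondFundamentalForm g G φ u v w = chartSecondFundamentalForm g G φ u w v := by
  rw [chartSecondFundamentalForm, chartSecondFundamentalForm, h.target.christoffel_symm,
    h.source.christoffel_symm,
    fderiv_fderiv_symm (h.contDiffAt.of_le (by norm_num : (2 : WithTop ℕ∞) ≤ 3))]

/-- Differentiates the identity `G(∇̄_w dφ z, dφ z') = g(∇_w z, z')` in direction `v`. By the Gauss
formula the tangential parts match, and one product of second fundamental forms remains. -/
theorem IsChartIsometricAt.metric_covDerivAlong_covDerivAlong [CompleteSpace E] [CompleteSpace F]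
    (h : IsChartIsometricAt g G φ u) (v w z z' : E) :
    G (φ u) (covDerivAlong G φ (fun u₁ ↦ covDerivAlong G φ (fun u' ↦ fderiv ℝ φ u' z) u₁ w) u v)
        (fderiv ℝ φ u z') =
      g u (covDerivAlong g id (fun u₁ ↦ covDerivAlong g id (fun _ ↦ z) u₁ w) u v) z'
      - G (φ u) (chartSecondFundamentalForm g G φ u w z)
          (chartSecondFundamentalForm g G φ u v z') := by
  have hφ : DifferentiableAt ℝ φ u := h.contDiffAt.differentiableAt (by norm_num)
  have hd : DifferentiableAt ℝ (fun u' ↦ fderiv ℝ φ u' z') u :=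
    (h.contDiffAt_fderiv_apply z').differentiableAt (by norm_num)
  have h1 : DifferentiableAt ℝ
      (fun u₁ ↦ covDerivAlong G φ (fun u' ↦ fderiv ℝ φ u' z) u₁ w) u :=
    (contDiffAt_covDerivAlong h.target h.contDiffAt
      (h.contDiffAt_fderiv_apply z) w).differentiableAt (by norm_num)
  have h2 : DifferentiableAt ℝ (fun u₁ ↦ covDerivAlong g id (fun _ ↦ z) u₁ w) u :=
    (contDiffAt_covDerivAlong (φ := id) h.source contDiffAt_id
      contDiffAt_const w).differentiableAt (by norm_num)
  have h3 := fderiv_metric_apply h.target hφ h1 hd v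
  have h4 := fderiv_metric_apply (φ := id) h.source differentiableAt_id h2
    (differentiableAt_const z') v
  have h5 : (fun u' ↦ G (φ u') (covDerivAlong G φ (fun u' ↦ fderiv ℝ φ u' z) u' w)
      (fderiv ℝ φ u' z')) =ᶠ[𝓝 u]
      fun u' ↦ g (id u') (covDerivAlong g id (fun _ ↦ z) u' w) z' := by
    filter_upwards [h.eventually] with u' hu'
    rw [hu'.metric_covDerivAlong_fderiv, covDerivAlong_id_const, id, hu'.source.apply_christoffel]
  rw [h5.fderiv_eq, h4] at h3
  rw [h.covDerivAlong_fderiv_eq w z, h.covDerivAlong_fderiv_eq v z'] at h3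
  simp only [map_add, add_apply, h.metric_fderiv, h.metric_secondFundamentalForm_fderiv,
    h.target.symm (φ u) (fderiv ℝ φ u _) (chartSecondFundamentalForm g G φ u _ _), id] at h3
  linarith

/-- The Gauss equation. -/
theorem IsChartIsometricAt.gauss [CompleteSpace E] [CompleteSpace F]
    (h : IsChartIsometricAt g G φ u) (v w z z' : E) :
    g u (chartCurvature g u v w z) z' =
      G (φ u) (chartCurvature G (φ u) (fderiv ℝ φ u v) (fderiv ℝ φ u w) (fderiv ℝ φ u z))
        (fderiv ℝ φ u z')
      + G (φ u) (chartSecondFundamentalForm g G φ u w z) (chartSecondFundamentalForm g G φ u v z')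
      - G (φ u) (chartSecondFundamentalForm g G φ u v z)
          (chartSecondFundamentalForm g G φ u w z') := by
  rw [← covDerivAlong_commutator h.target h.contDiffAt (h.contDiffAt_fderiv_apply z) v w,
    map_sub, sub_apply, h.metric_covDerivAlong_covDerivAlong,
    h.metric_covDerivAlong_covDerivAlong, chartCurvature, map_sub, sub_apply]
  ring

theorem IsChartIsometricAt.metric_normalPart_fderiv (h : IsChartIsometricAt g G φ u) (y : F)
    (z : E) : G (φ u) (chartNormalPart g G φ u y) (fderiv ℝ φ u z) = 0 := by
  rw [chartNormalPart, map_sub, sub_apply, h.metric_fderiv,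
    h.source.isInvertible.self_apply_inverse]
  simp

theorem metric_chartNormalPart (y : F) {η : F} (hη : ∀ z, G (φ u) (fderiv ℝ φ u z) η = 0) :
    G (φ u) (chartNormalPart g G φ u y) η = G (φ u) y η := by
  rw [chartNormalPart, map_sub, sub_apply, hη, sub_zero]

/-- The tangential part of `∇̄_w ξ`. -/
def chartTangentialDeriv (g : E → E →L[ℝ] E →L[ℝ] ℝ) (G : F → F →L[ℝ] F →L[ℝ] ℝ)
    (φ : E → F) (ξ : E → F) (w u : E) : E :=
  (g u).inverse ((G (φ u) (covDerivAlong G φ ξ u w)) ∘L fderiv ℝ φ u)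

theorem chartNormalDeriv_eq (ξ : E → F) (w : E) :
    chartNormalDeriv g G φ ξ u w =
      covDerivAlong G φ ξ u w - fderiv ℝ φ u (chartTangentialDeriv g G φ ξ w u) := rfl

theorem IsChartIsometricAt.contDiffAt_tangentialDeriv [CompleteSpace E] [CompleteSpace F]
    (h : IsChartIsometricAt g G φ u) {ξ : E → F} (hξ : ContDiffAt ℝ 2 ξ u) (w : E) :
    ContDiffAt ℝ 1 (chartTangentialDeriv g G φ ξ w) u := by
  have h1 : ContDiffAt ℝ 1 (fun u ↦ (g u).inverse) u :=
    (h.source.isInvertible.contDiffAt_map_inverse (n := 1)).comp u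
      (h.source.contDiffAt.of_le (by norm_num))
  have h2 : ContDiffAt ℝ 1 (fun u ↦ G (φ u)) u :=
    (h.target.contDiffAt.comp u h.contDiffAt).of_le (by norm_num)
  exact h1.clm_apply ((h2.clm_apply (contDiffAt_covDerivAlong h.target h.contDiffAt hξ w)).clm_comp
    (h.contDiffAt.fderiv_right (by norm_num)))

/-- The Weingarten formula: the tangential part of `∇̄_w ξ` is `-A_ξ w`. -/
theorem IsChartIsometricAt.metric_tangentialDeriv
    (h : IsChartIsometricAt g G φ u) {ξ : E → F} (hξ : DifferentiableAt ℝ ξ u)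
    (hn : ∀ᶠ u' in 𝓝 u, ∀ z, G (φ u') (ξ u') (fderiv ℝ φ u' z) = 0) (w z : E) :
    g u (chartTangentialDeriv g G φ ξ w u) z =
      - G (φ u) (chartSecondFundamentalForm g G φ u w z) (ξ u) := by
  have h1 := fderiv_metric_apply h.target (h.contDiffAt.differentiableAt (by norm_num)) hξ
    ((h.contDiffAt_fderiv_apply z).differentiableAt (by norm_num)) w
  have h2 : (fun u' ↦ G (φ u') (ξ u') (fderiv ℝ φ u' z)) =ᶠ[𝓝 u] fun _ ↦ 0 := by
    filter_upwards [hn] with u' hu' using hu' z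
  rw [h2.fderiv_eq, h.covDerivAlong_fderiv_eq, map_add, hn.self_of_nhds, zero_add,
    h.target.symm _ (ξ u)] at h1
  simp only [fderiv_fun_const, Pi.zero_apply, zero_apply] at h1
  rw [chartTangentialDeriv, h.source.isInvertible.self_apply_inverse,
    ContinuousLinearMap.comp_apply]
  linarith

/-- The inner normal derivative differs from `∇̄_w ξ` by a tangential field `dφ B`. Differentiating
that field adds `h(v, B)` and a further tangential vector, which `η` does not see. -/
theorem IsChartIsometricAt.metric_normalDeriv_normalDeriv [CompleteSpace E] [CompleteSpace F]
    (h : IsChartIsometricAt g G φ u) {ξ : E → F} (hξ : ContDiffAt ℝ 2 ξ u) (v w : E)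
    {η : F} (hη : ∀ z, G (φ u) (fderiv ℝ φ u z) η = 0) :
    G (φ u) (chartNormalDeriv g G φ (fun u' ↦ chartNormalDeriv g G φ ξ u' w) u v) η =
      G (φ u) (covDerivAlong G φ (fun u' ↦ covDerivAlong G φ ξ u' w) u v) η
      - G (φ u) (chartSecondFundamentalForm g G φ u v (chartTangentialDeriv g G φ ξ w u)) η := by
  have h1 : DifferentiableAt ℝ (fun u' ↦ covDerivAlong G φ ξ u' w) u :=
    (contDiffAt_covDerivAlong h.target h.contDiffAt hξ w).differentiableAt (by norm_num)
  have h2 : DifferentiableAt ℝ (chartTangentialDeriv g G φ ξ w) u :=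
    (h.contDiffAt_tangentialDeriv hξ w).differentiableAt (by norm_num)
  rw [chartNormalDeriv, metric_chartNormalPart _ hη]
  simp only [chartNormalDeriv_eq]
  set B := chartTangentialDeriv g G φ ξ w
  have h3 : covDerivAlong G φ
      (fun u' ↦ covDerivAlong G φ ξ u' w - fderiv ℝ φ u' (B u')) u v =
      covDerivAlong G φ (fun u' ↦ covDerivAlong G φ ξ u' w) u v
      - (chartSecondFundamentalForm g G φ u v (B u)
        + fderiv ℝ φ u (fderiv ℝ B u v + christoffel g u v (B u))) := by
    rw [covDerivAlong_eq, covDerivAlong_eq G φ (fun u' ↦ covDerivAlong G φ ξ u' w),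
      (h1.hasFDerivAt.fun_sub
        (h.differentiableAt_fderiv.hasFDerivAt.clm_apply h2.hasFDerivAt)).fderiv,
      chartSecondFundamentalForm, ← christoffelCLM_apply G]
    simp only [map_add, map_sub, sub_apply, add_apply, ContinuousLinearMap.comp_apply,
      ContinuousLinearMap.flip_apply]
    abel
  rw [h3, map_sub, map_add, sub_apply, add_apply, hη, add_zero]

/-- The Ricci equation. -/
theorem IsChartIsometricAt.ricci [CompleteSpace E] [CompleteSpace F]
    (h : IsChartIsometricAt g G φ u) {ξ : E → F} (hξ : ContDiffAt ℝ 2 ξ u) (v w : E)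
    {η : F} (hη : ∀ z, G (φ u) (fderiv ℝ φ u z) η = 0) :
    G (φ u) (chartNormalCurvature g G φ ξ u v w) η =
      G (φ u) (chartCurvature G (φ u) (fderiv ℝ φ u v) (fderiv ℝ φ u w) (ξ u)) η
      - G (φ u) (chartSecondFundamentalForm g G φ u v (chartTangentialDeriv g G φ ξ w u)) η
      + G (φ u) (chartSecondFundamentalForm g G φ u w (chartTangentialDeriv g G φ ξ v u)) η := by
  rw [← covDerivAlong_commutator h.target h.contDiffAt hξ v w, chartNormalCurvature, map_sub,
    sub_apply, h.metric_normalDeriv_normalDeriv hξ v w hη,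
    h.metric_normalDeriv_normalDeriv hξ w v hη, map_sub, sub_apply]
  ring

theorem IsChartIsometricAt.metric_normalCurvature_fderiv (h : IsChartIsometricAt g G φ u)
    (ξ : E → F) (v w z : E) :
    G (φ u) (chartNormalCurvature g G φ ξ u v w) (fderiv ℝ φ u z) = 0 := by
  rw [chartNormalCurvature, map_sub, sub_apply, chartNormalDeriv, chartNormalDeriv,
    h.metric_normalPart_fderiv, h.metric_normalPart_fderiv, sub_zero]

end ChartImmersion

/-! ### Algebra of curvature-like functions -/

section CurvatureLike

/-- A curvature-like function with vanishing sectional curvatures vanishes. -/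
theorem curvatureLike_eq_zero {V : Type*} [AddCommGroup V] (T : V → V → V → V → ℝ)
    (hadd : ∀ x x' y z w, T (x + x') y z w = T x y z w + T x' y z w)
    (hswap : ∀ x y z w, T x y z w = - T y x z w)
    (hskew : ∀ x y z w, T x y z w = - T x y w z)
    (hbianchi : ∀ x y z w, T x y z w + T y z x w + T z x y w = 0)
    (hzero : ∀ x y, T x y y x = 0) (x y z w : V) : T x y z w = 0 := by
  -- Pair symmetry, from four instances of the Bianchi identity and the two antisymmetries.
  have hpair (x y z w : V) : T x y z w = T z w x y := by
    linarith [hbianchi x y z w, hbianchi y z w x, hbianchi z w x y, hbianchi w x y z,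
      hskew x y z w, hskew y z x w, hskew z x y w, hskew z w y x, hskew w y z x,
      hskew w x z y, hskew x z w y, hswap z x w y, hswap x z y w, hskew x y w z, hswap w y x z,
      hskew z w x y, hswap y z w x, hskew w x y z, hskew y w x z, hswap w y z x, hswap y w z x,
      hskew x z y w, hswap y z x w, hskew z y x w]
  -- Polarisation in the outer arguments; below, polarisation in the middle ones yields `hcyc`.
  have hxyyz (x y z : V) : T x y y z = 0 := by
    have h := hzero (x + z) y
    rw [hadd, hpair x y y (x + z), hpair z y y (x + z), hswap y (x + z) x y,
      hswap y (x + z) z y, hadd, hadd] at h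
    linarith [hswap x y x y, hskew x y x y, hzero x y, hzero z y, hpair x y z y, hskew x y z y,
      hskew z y x y, hskew z y z y]
  have hcyc (x y z w : V) : T x y z w = - T x z y w := by
    have h := hxyyz x (y + z) w
    have hadd₂ (x y y' z w : V) : T x (y + y') z w = T x y z w + T x y' z w := by
      rw [hswap, hadd, hswap y x, hswap y' x]; ring
    have hadd₃ (x y z z' w : V) : T x y (z + z') w = T x y z w + T x y z' w := by
      rw [hpair, hadd, hpair z w, hpair z' w]
    rw [hadd₂, hadd₃, hadd₃] at h
    linarith [hxyyz x y w, hxyyz x z w]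
  -- Antisymmetry in the first two and in the middle two arguments makes `T` invariant under cyclic
  -- permutation of the first three, so the Bianchi sum is `3 T`.
  linarith [hbianchi x y z w, hcyc x y z w, hswap y z x w, hcyc y x z w, hswap x y z w,
    hcyc x z y w, hswap z x y w, hcyc y z x w]

end CurvatureLike

/-! ### The Casorati inequality for bilinear maps, and adapted bases -/

section Bilinear

variable {T W X : Type*} [NormedAddCommGroup T] [InnerProductSpace ℝ T]
  [NormedAddCommGroup W] [InnerProductSpace ℝ W] [AddCommGroup X] [Module ℝ X]
  {ι κ : Type*} [Fintype ι] [Fintype κ]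

/-- The metric trace of a bilinear map does not depend on the orthonormal basis. -/
theorem sum_apply_orthonormalBasis_eq (b : OrthonormalBasis ι ℝ T) (b' : OrthonormalBasis κ ℝ T)
    (C : T →ₗ[ℝ] T →ₗ[ℝ] X) : ∑ i, C (b i) (b i) = ∑ i, C (b' i) (b' i) := by
  classical
  have h1 (i : ι) : C (b i) (b i) =
      ∑ k, ∑ l, (⟪b' k, b i⟫_ℝ * ⟪b i, b' l⟫_ℝ) • C (b' k) (b' l) := by
    conv_lhs => rw [← b'.sum_repr' (b i)]
    simp only [map_sum, map_smul, LinearMap.sum_apply, LinearMap.smul_apply, Finset.smul_sum,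
      smul_smul]
    rw [Finset.sum_comm]
    refine Finset.sum_congr rfl fun k _ ↦ Finset.sum_congr rfl fun l _ ↦ ?_
    rw [real_inner_comm (b i) (b' l), mul_comm]
  simp only [h1]
  rw [Finset.sum_comm]
  refine Finset.sum_congr rfl fun k _ ↦ ?_
  rw [Finset.sum_comm]
  simp only [← Finset.sum_smul, b.sum_inner_mul_inner]
  rw [Finset.sum_eq_single k]
  · simp
  · intro l _ hl
    simp [b'.inner_eq_ite, hl.symm]
  · simp

theorem sum_norm_sq_orthonormalBasis_eq (b : OrthonormalBasis ι ℝ T)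
    (b' : OrthonormalBasis κ ℝ T) (f : T →ₗ[ℝ] W) :
    ∑ i, ‖f (b i)‖ ^ 2 = ∑ i, ‖f (b' i)‖ ^ 2 := by
  simpa using sum_apply_orthonormalBasis_eq b b' ((innerₗ W).compl₁₂ f f)

/-- One argument is changed at a time. This makes the Casorati curvatures independent of the bases
chosen in their definitions. -/
theorem sum_sum_norm_sq_orthonormalBasis_eq (b : OrthonormalBasis ι ℝ T)
    (b' : OrthonormalBasis κ ℝ T) (B : T →ₗ[ℝ] T →ₗ[ℝ] W) :
    ∑ i, ∑ j, ‖B (b i) (b j)‖ ^ 2 = ∑ i, ∑ j, ‖B (b' i) (b' j)‖ ^ 2 := by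
  calc ∑ i, ∑ j, ‖B (b i) (b j)‖ ^ 2 = ∑ i, ∑ j, ‖B (b i) (b' j)‖ ^ 2 :=
        Finset.sum_congr rfl fun i _ ↦ sum_norm_sq_orthonormalBasis_eq b b' (B (b i))
    _ = ∑ j, ∑ i, ‖B (b i) (b' j)‖ ^ 2 := Finset.sum_comm
    _ = ∑ j, ∑ i, ‖B (b' i) (b' j)‖ ^ 2 :=
        Finset.sum_congr rfl fun j _ ↦ sum_norm_sq_orthonormalBasis_eq b b' (B.flip (b' j))
    _ = ∑ i, ∑ j, ‖B (b' i) (b' j)‖ ^ 2 := Finset.sum_comm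

/-- The squared norm of the restriction of `B` to `L`. -/
def restrictNormSq [FiniteDimensional ℝ T] (B : T →ₗ[ℝ] T →ₗ[ℝ] W) (L : Submodule ℝ T) : ℝ :=
  ∑ i, ∑ j, ‖B (stdOrthonormalBasis ℝ L i : T) (stdOrthonormalBasis ℝ L j)‖ ^ 2

theorem restrictNormSq_eq [FiniteDimensional ℝ T] (B : T →ₗ[ℝ] T →ₗ[ℝ] W) (L : Submodule ℝ T)
    (f : OrthonormalBasis ι ℝ L) :
    restrictNormSq B L = ∑ i, ∑ j, ‖B (f i : T) (f j)‖ ^ 2 :=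
  sum_sum_norm_sq_orthonormalBasis_eq (stdOrthonormalBasis ℝ L) f
    (B.compl₁₂ L.subtype L.subtype)

theorem exists_orthonormalBasis_castSucc [FiniteDimensional ℝ T] {l : ℕ}
    (hT : Module.finrank ℝ T = l + 1) (L : Submodule ℝ T) (f : OrthonormalBasis (Fin l) ℝ L) :
    ∃ b : OrthonormalBasis (Fin (l + 1)) ℝ T, ∀ i, b (Fin.castSucc i) = f i := by
  have hf : Orthonormal ℝ (fun i ↦ (f i : T)) := f.orthonormal.comp_linearIsometry L.subtypeₗᵢ
  obtain ⟨b, hb⟩ := Orthonormal.exists_orthonormalBasis_extension_of_card_eq (𝕜 := ℝ) (E := T)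
    (ι := Fin (l + 1)) (by simpa using hT)
    (v := Fin.snoc (α := fun _ ↦ T) (fun i ↦ (f i : T)) 0) (s := Set.range Fin.castSucc) (by
      have : Orthonormal ℝ (fun i : Set.range (Fin.castSucc : Fin l → _) ↦
          (f (Classical.choose i.2) : T)) := by
        refine hf.comp _ fun i j hij ↦ ?_
        apply Subtype.ext
        rw [← Classical.choose_spec i.2, ← Classical.choose_spec j.2]
        exact congrArg _ hij
      convert this using 1
      ext1 i
      conv_lhs => rw [Set.domRestrict_apply, ← Classical.choose_spec i.2]
      exact Fin.snoc_castSucc (α := fun _ ↦ T) _ _ _)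
  refine ⟨b, fun i ↦ ?_⟩
  rw [hb _ ⟨i, rfl⟩]
  exact Fin.snoc_castSucc (α := fun _ ↦ T) _ _ _

theorem exists_orthonormalBasis_last [FiniteDimensional ℝ T] {l : ℕ}
    (hT : Module.finrank ℝ T = l + 1) (L : Submodule ℝ T) (hL : Module.finrank ℝ L = l) :
    ∃ b : OrthonormalBasis (Fin (l + 1)) ℝ T, b (Fin.last l) ∈ Lᗮ ∧
      ∀ B : T →ₗ[ℝ] T →ₗ[ℝ] W, restrictNormSq B L =
        ∑ i : Fin l, ∑ j : Fin l, ‖B (b i.castSucc) (b j.castSucc)‖ ^ 2 := by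
  set f := (stdOrthonormalBasis ℝ L).reindex (finCongr hL)
  obtain ⟨b, hb⟩ := exists_orthonormalBasis_castSucc hT L f
  refine ⟨b, ?_, fun B ↦ by rw [restrictNormSq_eq B L f]; simp only [hb]⟩
  rw [Submodule.mem_orthogonal]
  intro u hu
  have : u = ∑ i, ⟪f i, ⟨u, hu⟩⟫_ℝ • (f i : T) := by
    conv_lhs => rw [show u = ((⟨u, hu⟩ : L) : T) from rfl, ← f.sum_repr' ⟨u, hu⟩]
    simp
  rw [this, sum_inner]
  refine Finset.sum_eq_zero fun i _ ↦ ?_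
  rw [inner_smul_left, ← hb, b.inner_eq_zero (Fin.castSucc_lt_last i).ne, mul_zero]

/-- The squared norm of the restriction of `B` to the orthogonal complement of a unit vector `e`. -/
def hyperplaneNormSq [FiniteDimensional ℝ T] (B : T →ₗ[ℝ] T →ₗ[ℝ] W) (e : T) : ℝ :=
  ∑ i, ∑ j, ‖B (stdOrthonormalBasis ℝ T i) (stdOrthonormalBasis ℝ T j)‖ ^ 2
    - ∑ i, ‖B (stdOrthonormalBasis ℝ T i) e‖ ^ 2 - ∑ i, ‖B e (stdOrthonormalBasis ℝ T i)‖ ^ 2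
    + ‖B e e‖ ^ 2

/-- Inclusion–exclusion: remove the last row and column from the full sum and restore the corner.
Each resulting sum is independent of the basis, so only the last vector matters. -/
theorem sum_castSucc_eq_hyperplaneNormSq [FiniteDimensional ℝ T] {l : ℕ}
    (B : T →ₗ[ℝ] T →ₗ[ℝ] W) (b : OrthonormalBasis (Fin (l + 1)) ℝ T) :
    ∑ i : Fin l, ∑ j : Fin l, ‖B (b i.castSucc) (b j.castSucc)‖ ^ 2 =
      hyperplaneNormSq B (b (Fin.last l)) := by
  have h := sum_norm_sq_orthonormalBasis_eq (stdOrthonormalBasis ℝ T) b (B.flip (b (Fin.last l)))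
  simp only [LinearMap.flip_apply] at h
  rw [hyperplaneNormSq, sum_sum_norm_sq_orthonormalBasis_eq (stdOrthonormalBasis ℝ T) b, h,
    sum_norm_sq_orthonormalBasis_eq (stdOrthonormalBasis ℝ T) b (B (b (Fin.last l)))]
  simp only [Fin.sum_univ_castSucc, Finset.sum_add_distrib]
  ring

theorem restrictNormSq_orthogonal_singleton [FiniteDimensional ℝ T] {l : ℕ}
    (hT : Module.finrank ℝ T = l + 1) (B : T →ₗ[ℝ] T →ₗ[ℝ] W) {e : T} (he : ‖e‖ = 1) :
    Module.finrank ℝ (ℝ ∙ e)ᗮ = l ∧ restrictNormSq B (ℝ ∙ e)ᗮ = hyperplaneNormSq B e := by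
  have hspan : Module.finrank ℝ (ℝ ∙ e) = 1 :=
    finrank_span_singleton (fun h ↦ by simp [h] at he)
  have hL : Module.finrank ℝ (ℝ ∙ e)ᗮ = l := by
    have := (ℝ ∙ e).finrank_add_finrank_orthogonal
    omega
  obtain ⟨b, hlast, hb⟩ := exists_orthonormalBasis_last (W := W) hT _ hL
  refine ⟨hL, ?_⟩
  rw [hb, sum_castSucc_eq_hyperplaneNormSq]
  -- The last basis vector is `a • e` with `|a| = 1`, and `hyperplaneNormSq` does not change under
  -- such a factor.
  rw [Submodule.orthogonal_orthogonal, Submodule.mem_span_singleton] at hlast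
  obtain ⟨a, ha⟩ := hlast
  have h1 : ‖b (Fin.last l)‖ = 1 := b.orthonormal.1 _
  rw [← ha, norm_smul, he, mul_one, Real.norm_eq_abs] at h1
  rw [← ha, hyperplaneNormSq, hyperplaneNormSq]
  simp [norm_smul, h1]

/-- The hyperplane on which the restriction of `B` is smallest exists. -/
theorem exists_hyperplane_forall_restrictNormSq_le [FiniteDimensional ℝ T] {l : ℕ}
    (hT : Module.finrank ℝ T = l + 1) (B : T →ₗ[ℝ] T →ₗ[ℝ] W) :
    ∃ L₀ : Submodule ℝ T, Module.finrank ℝ L₀ = l ∧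
      ∀ L : Submodule ℝ T, Module.finrank ℝ L = l → restrictNormSq B L₀ ≤ restrictNormSq B L := by
  have : Nontrivial T := Module.nontrivial_of_finrank_pos (R := ℝ) (by omega)
  -- Parametrising hyperplanes by their unit normals reduces the problem to a continuous function on
  -- the compact unit sphere.
  have hcont : Continuous (hyperplaneNormSq B) := by
    have h1 (v : T) : Continuous fun e ↦ B v e := (B v).continuous_of_finiteDimensional
    have h2 (v : T) : Continuous fun e ↦ B e v := (B.flip v).continuous_of_finiteDimensional
    have h3 : Continuous fun e ↦ B e e := by
      have h4 (x e : T) : B x e = ∑ i, ⟪stdOrthonormalBasis ℝ T i, x⟫_ℝ •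
          B (stdOrthonormalBasis ℝ T i) e := by
        conv_lhs => rw [← (stdOrthonormalBasis ℝ T).sum_repr' x]
        simp only [map_sum, map_smul, LinearMap.sum_apply, LinearMap.smul_apply]
      simp only [fun e ↦ h4 e e]
      fun_prop
    unfold hyperplaneNormSq
    exact ((continuous_const.sub (continuous_finsetSum _ fun i _ ↦ (h1 _).norm.pow 2)).sub
      (continuous_finsetSum _ fun i _ ↦ (h2 _).norm.pow 2)).add (h3.norm.pow 2)
  have hne : (Metric.sphere (0 : T) 1).Nonempty := NormedSpace.sphere_nonempty.2 zero_le_one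
  obtain ⟨e, he, hmin⟩ := (isCompact_sphere (0 : T) 1).exists_isMinOn hne hcont.continuousOn
  obtain ⟨hL₀, hL₀e⟩ := restrictNormSq_orthogonal_singleton hT B (e := e) (by simpa using he)
  refine ⟨(ℝ ∙ e)ᗮ, hL₀, fun L hL ↦ ?_⟩
  obtain ⟨b, -, hb⟩ := exists_orthonormalBasis_last (W := W) hT L hL
  rw [hb, sum_castSucc_eq_hyperplaneNormSq, hL₀e]
  exact hmin (by simp [b.orthonormal.1])

/-- The remainder in the Casorati inequality as a sum of squares. -/
theorem casorati_identity {l : ℕ} (B : T →ₗ[ℝ] T →ₗ[ℝ] W) (b : OrthonormalBasis (Fin (l + 1)) ℝ T)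
    (H Λ : W) (hH : H = ∑ i, B (b i) (b i)) (hΛ : H = ((l : ℝ) + 2) • Λ) :
    ∑ i, ∑ j, ‖B (b i) (b j)‖ ^ 2
      + ∑ i : Fin l, ∑ j : Fin l, ‖B (b i.castSucc) (b j.castSucc)‖ ^ 2
      - 2 / ((l : ℝ) + 2) * ‖H‖ ^ 2 =
    2 * ∑ i : Fin l, ∑ j : Fin l,
        ‖B (b i.castSucc) (b j.castSucc) - if i = j then Λ else 0‖ ^ 2
      + ∑ i : Fin l, ‖B (b i.castSucc) (b (Fin.last l))‖ ^ 2
      + ∑ i : Fin l, ‖B (b (Fin.last l)) (b i.castSucc)‖ ^ 2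
      + ‖B (b (Fin.last l)) (b (Fin.last l)) - (2 : ℝ) • Λ‖ ^ 2 := by
  have h1 (i j : Fin l) : ‖B (b i.castSucc) (b j.castSucc) - if i = j then Λ else 0‖ ^ 2 =
      ‖B (b i.castSucc) (b j.castSucc)‖ ^ 2 +
        if i = j then ‖Λ‖ ^ 2 - 2 * ⟪B (b i.castSucc) (b i.castSucc), Λ⟫_ℝ else 0 := by
    split_ifs with hij
    · subst hij
      rw [norm_sub_sq_real]; ring
    · simp
  -- All cross terms of the squares add up to `-4⟪H, Λ⟫`. With the `2 l ‖Λ‖² + 4 ‖Λ‖²` from the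
  -- squares of `Λ` and `2 • Λ`, this leaves `-2 (l + 2) ‖Λ‖²`, the trace term in `h3`.
  have h2 : ∑ i : Fin l, ⟪B (b i.castSucc) (b i.castSucc), Λ⟫_ℝ
      + ⟪B (b (Fin.last l)) (b (Fin.last l)), Λ⟫_ℝ = ((l : ℝ) + 2) * ‖Λ‖ ^ 2 := by
    rw [← sum_inner, ← inner_add_left, ← Fin.sum_univ_castSucc (fun i ↦ B (b i) (b i)), ← hH, hΛ,
      inner_smul_left, real_inner_self_eq_norm_sq]
    simp
  have h3 : 2 / ((l : ℝ) + 2) * ‖H‖ ^ 2 = 2 * ((l : ℝ) + 2) * ‖Λ‖ ^ 2 := by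
    have : (l : ℝ) + 2 ≠ 0 := by positivity
    rw [hΛ, norm_smul, mul_pow, Real.norm_eq_abs, sq_abs]
    field_simp
  simp only [h1, Finset.sum_add_distrib, Finset.sum_ite_eq, Finset.mem_univ, if_true,
    Finset.sum_sub_distrib, ← Finset.mul_sum, Finset.sum_const, Finset.card_univ, Fintype.card_fin,
    nsmul_eq_mul, Fin.sum_univ_castSucc]
  rw [h3, norm_sub_sq_real, norm_smul, inner_smul_right, mul_pow, Real.norm_eq_abs, sq_abs]
  linear_combination 4 * h2

/-- The two-eigenvalue form of `B` for which the Casorati inequality is an equality. -/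
theorem casorati_identity_eq_zero_iff {l : ℕ} (B : T →ₗ[ℝ] T →ₗ[ℝ] W)
    (hB : ∀ v w, B v w = B w v)
    (b : OrthonormalBasis (Fin (l + 1)) ℝ T) :
    ∑ i, ∑ j, ‖B (b i) (b j)‖ ^ 2
      + ∑ i : Fin l, ∑ j : Fin l, ‖B (b i.castSucc) (b j.castSucc)‖ ^ 2
      - 2 / ((l : ℝ) + 2) * ‖∑ i, B (b i) (b i)‖ ^ 2 = 0 ↔
    ∃ Λ : W, ∀ i j, B (b i) (b j) =
      if i = j then (if i = Fin.last l then (2 : ℝ) else 1) • Λ else 0 := by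
  have hl : (l : ℝ) + 2 ≠ 0 := by positivity
  constructor
  · intro h
    -- The only possible choice: a form with diagonal `Λ, …, Λ, 2Λ` has trace `(l + 2) Λ`.
    set Λ : W := ((l : ℝ) + 2)⁻¹ • ∑ i, B (b i) (b i) with hΛ
    rw [casorati_identity B b _ Λ rfl (by rw [hΛ, smul_inv_smul₀ hl])] at h
    have p1 (i j : Fin l) : 0 ≤ ‖B (b i.castSucc) (b j.castSucc) - if i = j then Λ else 0‖ ^ 2 :=
      sq_nonneg _
    have p2 : 0 ≤ ∑ i : Fin l, ∑ j : Fin l,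
        ‖B (b i.castSucc) (b j.castSucc) - if i = j then Λ else 0‖ ^ 2 :=
      Finset.sum_nonneg fun i _ ↦ Finset.sum_nonneg fun j _ ↦ p1 i j
    have p3 : 0 ≤ ∑ i : Fin l, ‖B (b i.castSucc) (b (Fin.last l))‖ ^ 2 :=
      Finset.sum_nonneg fun i _ ↦ sq_nonneg _
    have p4 : 0 ≤ ∑ i : Fin l, ‖B (b (Fin.last l)) (b i.castSucc)‖ ^ 2 :=
      Finset.sum_nonneg fun i _ ↦ sq_nonneg _
    have p5 := sq_nonneg ‖B (b (Fin.last l)) (b (Fin.last l)) - (2 : ℝ) • Λ‖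
    have z2 : ∑ i : Fin l, ∑ j : Fin l,
        ‖B (b i.castSucc) (b j.castSucc) - if i = j then Λ else 0‖ ^ 2 = 0 := by linarith
    have z3 : ∑ i : Fin l, ‖B (b i.castSucc) (b (Fin.last l))‖ ^ 2 = 0 := by linarith
    have z5 : ‖B (b (Fin.last l)) (b (Fin.last l)) - (2 : ℝ) • Λ‖ ^ 2 = 0 := by linarith
    have e2 (i j : Fin l) : B (b i.castSucc) (b j.castSucc) = if i = j then Λ else 0 := by
      rw [Finset.sum_eq_zero_iff_of_nonneg
        fun i _ ↦ Finset.sum_nonneg fun j _ ↦ p1 i j] at z2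
      have := (Finset.sum_eq_zero_iff_of_nonneg fun j _ ↦ p1 i j).1 (z2 i (Finset.mem_univ _)) j
        (Finset.mem_univ _)
      simpa [sub_eq_zero] using this
    have e3 (i : Fin l) : B (b i.castSucc) (b (Fin.last l)) = 0 := by
      have := (Finset.sum_eq_zero_iff_of_nonneg fun i _ ↦ sq_nonneg _).1 z3 i (Finset.mem_univ _)
      simpa using this
    have e5 : B (b (Fin.last l)) (b (Fin.last l)) = (2 : ℝ) • Λ := by
      simpa [sub_eq_zero] using z5
    refine ⟨Λ, fun i j ↦ ?_⟩
    induction i using Fin.lastCases with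
    | last =>
      induction j using Fin.lastCases with
      | last => simp [e5]
      | cast j => rw [hB, e3]; simp [(Fin.castSucc_lt_last j).ne']
    | cast i =>
      induction j using Fin.lastCases with
      | last => rw [e3]; simp [(Fin.castSucc_lt_last i).ne]
      | cast j => simp [e2]
  · rintro ⟨Λ, h⟩
    have hne (i : Fin l) : Fin.last l ≠ i.castSucc := (Fin.castSucc_lt_last i).ne'
    rw [casorati_identity B b _ Λ rfl]
    · simp [h, hne]
    · rw [Fin.sum_univ_castSucc]
      simp only [h, if_true, Fin.castSucc_ne_last, if_false, one_smul, Finset.sum_const,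
        Finset.card_univ, Fintype.card_fin, ← Nat.cast_smul_eq_nsmul ℝ, ← add_smul]

theorem casorati_identity_nonneg {l : ℕ} (B : T →ₗ[ℝ] T →ₗ[ℝ] W)
    (b : OrthonormalBasis (Fin (l + 1)) ℝ T) :
    0 ≤ ∑ i, ∑ j, ‖B (b i) (b j)‖ ^ 2
      + ∑ i : Fin l, ∑ j : Fin l, ‖B (b i.castSucc) (b j.castSucc)‖ ^ 2
      - 2 / ((l : ℝ) + 2) * ‖∑ i, B (b i) (b i)‖ ^ 2 := by
  have hl : (l : ℝ) + 2 ≠ 0 := by positivity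
  rw [casorati_identity B b _ (((l : ℝ) + 2)⁻¹ • ∑ i, B (b i) (b i)) rfl
    (by rw [smul_inv_smul₀ hl])]
  positivity

/-- The optimal Casorati inequality for a symmetric vector-valued bilinear map, with its equality
case. -/
theorem casorati_inequality [FiniteDimensional ℝ T] {l : ℕ} (hl : 1 ≤ l)
    (hT : Module.finrank ℝ T = l + 1) (B : T →ₗ[ℝ] T →ₗ[ℝ] W) (hB : ∀ v w, B v w = B w v)
    (e : OrthonormalBasis ι ℝ T) {S I : ℝ} (hS : S = ∑ i, ∑ j, ‖B (e i) (e j)‖ ^ 2)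
    (hI : I = sInf {c : ℝ | ∃ L : Submodule ℝ T, Module.finrank ℝ L + 1 = l + 1 ∧
      c = 1 / (Module.finrank ℝ L : ℝ) * restrictNormSq B L}) :
    (‖∑ i, B (e i) (e i)‖ ^ 2 - S) / (((l : ℝ) + 1) * l)
        ≤ 1 / 2 * (1 / ((l : ℝ) + 1) * S) + ((l : ℝ) + 2) / (2 * ((l : ℝ) + 1)) * I ∧
    ((‖∑ i, B (e i) (e i)‖ ^ 2 - S) / (((l : ℝ) + 1) * l)
        = 1 / 2 * (1 / ((l : ℝ) + 1) * S) + ((l : ℝ) + 2) / (2 * ((l : ℝ) + 1)) * I ↔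
      ∃ (b : OrthonormalBasis (Fin (l + 1)) ℝ T) (Λ : W), ∀ i j, B (b i) (b j) =
        if i = j then (if i = Fin.last l then (2 : ℝ) else 1) • Λ else 0) := by
  obtain ⟨L₀, hL₀, hmin⟩ := exists_hyperplane_forall_restrictNormSq_le hT B
  have hl0 : (0 : ℝ) < l := by exact_mod_cast hl
  -- The infimum is attained, so the remainder can be evaluated at the single hyperplane `L₀`.
  have hI' : I = 1 / (l : ℝ) * restrictNormSq B L₀ := by
    rw [hI]
    refine IsLeast.csInf_eq ⟨⟨L₀, by rw [hL₀], by rw [hL₀]⟩, ?_⟩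
    rintro _ ⟨L, hL, rfl⟩
    have hL' : Module.finrank ℝ L = l := by omega
    rw [hL']
    exact mul_le_mul_of_nonneg_left (hmin L hL') (by positivity)
  obtain ⟨b₀, -, hb₀⟩ := exists_orthonormalBasis_last (W := W) hT L₀ hL₀
  set Q := S + restrictNormSq B L₀ - 2 / ((l : ℝ) + 2) * ‖∑ i, B (e i) (e i)‖ ^ 2 with hQ
  have hQ₀ (b : OrthonormalBasis (Fin (l + 1)) ℝ T) : S = ∑ i, ∑ j, ‖B (b i) (b j)‖ ^ 2 := by
    rw [hS, sum_sum_norm_sq_orthonormalBasis_eq e b]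
  have hQnonneg : 0 ≤ Q := by
    rw [hQ, hQ₀ b₀, hb₀, sum_apply_orthonormalBasis_eq e b₀]
    exact casorati_identity_nonneg B b₀
  have key : 1 / 2 * (1 / ((l : ℝ) + 1) * S) + ((l : ℝ) + 2) / (2 * ((l : ℝ) + 1)) * I
      - (‖∑ i, B (e i) (e i)‖ ^ 2 - S) / (((l : ℝ) + 1) * l) =
      ((l : ℝ) + 2) / (2 * ((l : ℝ) + 1) * l) * Q := by
    rw [hQ, hI']
    field_simp
    ring
  have hpos : 0 < ((l : ℝ) + 2) / (2 * ((l : ℝ) + 1) * l) := by positivity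
  refine ⟨by nlinarith [mul_nonneg hpos.le hQnonneg], ?_⟩
  rw [eq_comm, ← sub_eq_zero, key, mul_eq_zero, or_iff_right hpos.ne']
  constructor
  · intro h
    refine ⟨b₀, (casorati_identity_eq_zero_iff B hB b₀).1 ?_⟩
    rw [← hQ₀ b₀, ← hb₀, ← sum_apply_orthonormalBasis_eq e b₀]
    exact h
  · rintro ⟨b, h⟩
    have h0 := (casorati_identity_eq_zero_iff B hB b).2 h
    -- The hyperplane normal to the last vector of `b` has zero remainder. Minimality of `L₀` then
    -- gives `Q ≤ 0`, so `Q = 0`.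
    obtain ⟨hL, hLe⟩ := restrictNormSq_orthogonal_singleton hT B (b.orthonormal.1 (Fin.last l))
    rw [← hQ₀ b, sum_castSucc_eq_hyperplaneNormSq, ← hLe,
      ← sum_apply_orthonormalBasis_eq e b] at h0
    linarith [hmin _ hL]

/-- An orthonormal basis whose first vector is aligned with a given vector. -/
theorem exists_orthonormalBasis_inner_eq [FiniteDimensional ℝ W] {p : ℕ}
    (hW : Module.finrank ℝ W = p) (Λ : W) :
    ∃ (ξ : OrthonormalBasis (Fin p) ℝ W) (a : ℝ),
      ∀ r : Fin p, ⟪Λ, ξ r⟫_ℝ = if (r : ℕ) = 0 then a else 0 := by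
  by_cases hΛ : Λ = 0
  · exact ⟨(stdOrthonormalBasis ℝ W).reindex (finCongr hW), 0, fun r ↦ by simp [hΛ]⟩
  have : Nontrivial W := ⟨Λ, 0, hΛ⟩
  -- A nonzero `Λ` guarantees that the index `0` exists; the case `p = 0` falls under `Λ = 0`.
  have hp : 0 < p := hW ▸ Module.finrank_pos
  have hunit : ‖‖Λ‖⁻¹ • Λ‖ = 1 := by
    rw [norm_smul, norm_inv, norm_norm, inv_mul_cancel₀ (norm_ne_zero_iff.2 hΛ)]
  obtain ⟨ξ, hξ⟩ := Orthonormal.exists_orthonormalBasis_extension_of_card_eq (𝕜 := ℝ) (E := W)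
    (ι := Fin p) (by simpa using hW) (v := fun _ ↦ ‖Λ‖⁻¹ • Λ) (s := {⟨0, hp⟩}) (by
      refine ⟨fun _ ↦ hunit, fun i j hij ↦ ?_⟩
      exact absurd (Subsingleton.elim i j) hij)
  have h0 : ξ ⟨0, hp⟩ = ‖Λ‖⁻¹ • Λ := hξ _ rfl
  have hΛ' : Λ = ‖Λ‖ • ξ ⟨0, hp⟩ := by rw [h0, smul_inv_smul₀ (norm_ne_zero_iff.2 hΛ)]
  refine ⟨ξ, ‖Λ‖, fun r ↦ ?_⟩
  conv_lhs => rw [hΛ', inner_smul_left, ξ.inner_eq_ite]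
  by_cases hr : (r : ℕ) = 0
  · simp [hr, Fin.ext_iff]
  · simp [hr, Fin.ext_iff, Ne.symm hr]

/-- A bilinear map of the form `∑ i, μ i • e_i ⊗ e_i ⊗ Λ` has commuting shape operators. -/
theorem apply_comm_of_diagonal (B : T →ₗ[ℝ] T →ₗ[ℝ] W) (e : OrthonormalBasis ι ℝ T)
    [DecidableEq ι] (μ : ι → ℝ) (Λ ξ : W)
    (hB : ∀ i j, B (e i) (e j) = if i = j then μ i • Λ else 0) {v w v' w' : T}
    (hv : ∀ z, ⟪v', z⟫_ℝ = - ⟪B v z, ξ⟫_ℝ) (hw : ∀ z, ⟪w', z⟫_ℝ = - ⟪B w z, ξ⟫_ℝ) :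
    B v w' = B w v' := by
  have h1 (v z : T) : B v z = ∑ i, (⟪e i, v⟫_ℝ * ⟪e i, z⟫_ℝ * μ i) • Λ := by
    conv_lhs => rw [← e.sum_repr' v, ← e.sum_repr' z]
    simp only [map_sum, map_smul, LinearMap.sum_apply, LinearMap.smul_apply, hB, smul_ite,
      smul_zero, Finset.sum_ite_eq', Finset.mem_univ, if_true, smul_smul]
    refine Finset.sum_congr rfl fun i _ ↦ ?_
    ring_nf
  -- The vectors `v'`, `w'` are `-A_ξ v`, `-A_ξ w`; in the basis `e` they are obtained by
  -- coordinatewise scaling, so both sides become the same sum.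
  have h2 {v v' : T} (hv : ∀ z, ⟪v', z⟫_ℝ = - ⟪B v z, ξ⟫_ℝ) (i : ι) :
      ⟪e i, v'⟫_ℝ = - (⟪e i, v⟫_ℝ * μ i * ⟪Λ, ξ⟫_ℝ) := by
    rw [real_inner_comm, hv, h1]
    simp [e.inner_eq_ite, inner_smul_left]
  rw [h1 v w', h1 w v']
  refine Finset.sum_congr rfl fun i _ ↦ ?_
  rw [h2 hv, h2 hw]
  ring_nf

/-- The condition `(i : ℕ) + 1 = l + 1` selects the last index; the remaining basis vectors span the
orthogonal complement and share the eigenvalue `α`. -/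
theorem quasiUmbilical_of_toMatrix_eq_diagonal {l : ℕ} (A : T →ₗ[ℝ] T)
    (e : OrthonormalBasis (Fin (l + 1)) ℝ T) (α β : ℝ)
    (hA : LinearMap.toMatrix e.toBasis e.toBasis A =
      Matrix.diagonal fun i : Fin (l + 1) ↦ if (i : ℕ) + 1 = l + 1 then β else α) :
    A (e (Fin.last l)) = β • e (Fin.last l) ∧
      ∀ v, ⟪v, e (Fin.last l)⟫_ℝ = 0 → A v = α • v := by
  have hAe (j : Fin (l + 1)) : A (e j) = (if (j : ℕ) + 1 = l + 1 then β else α) • e j := by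
    have h1 := e.toBasis.sum_repr (A (e j))
    simp only [← OrthonormalBasis.coe_toBasis, ← LinearMap.toMatrix_apply, hA,
      Matrix.diagonal_apply] at h1
    rw [OrthonormalBasis.coe_toBasis] at h1
    rw [← h1]
    simp
  refine ⟨by simpa using hAe (Fin.last l), fun v hv ↦ ?_⟩
  conv_lhs => rw [← e.sum_repr' v]
  conv_rhs => rw [← e.sum_repr' v]
  rw [map_sum, Finset.smul_sum]
  refine Finset.sum_congr rfl fun i _ ↦ ?_
  rw [map_smul, hAe]
  induction i using Fin.lastCases with
  | last => rw [real_inner_comm, hv]; simp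
  | cast i => simp [i.2.ne, smul_smul, mul_comm]

end Bilinear

/-! ### The metric of a manifold in its preferred chart -/

section ManifoldMetric

set_option maxSynthPendingDepth 3
set_option synthInstance.maxHeartbeats 200000

variable (m : ℕ) {M : Type*} [TopologicalSpace M] [ChartedSpace (EuclideanSpace ℝ (Fin m)) M]
  [RiemannianBundle (fun x : M ↦ TangentSpace (𝓡 m) x)]

/-- The inner product of the tangent space at `y`, as a function on the model space. -/
def tangentInner (y : M) (a b : EuclideanSpace ℝ (Fin m)) : ℝ :=
  inner ℝ (E := TangentSpace (𝓡 m) y) a b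

theorem chartMetric_apply (x : M) (u v w : EuclideanSpace ℝ (Fin m)) :
    chartMetric m x u v w = tangentInner m ((extChartAt (𝓡 m) x).symm u)
      (mfderiv 𝓘(ℝ, EuclideanSpace ℝ (Fin m)) (𝓡 m) (extChartAt (𝓡 m) x).symm u v)
      (mfderiv 𝓘(ℝ, EuclideanSpace ℝ (Fin m)) (𝓡 m) (extChartAt (𝓡 m) x).symm u w) := rfl

theorem chartMetric_symm (x : M) (u v w : EuclideanSpace ℝ (Fin m)) :
    chartMetric m x u v w = chartMetric m x u w v := by
  exact real_inner_comm (F := TangentSpace (𝓡 m) ((extChartAt (𝓡 m) x).symm u)) _ _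

/-- Since `T_x M` is read in the preferred chart at `x`, the inverse chart has identity derivative
at the base point. -/
theorem chartMetric_self [IsManifold (𝓡 m) ∞ M] (x : M) (v w : TangentSpace (𝓡 m) x) :
    chartMetric m x (extChartAt (𝓡 m) x x) v w = ⟪v, w⟫_ℝ := by
  have : IsManifold (𝓡 m) 1 M := IsManifold.of_le (n := ∞) (by simp)
  have h := mfderivWithin_range_extChartAt_symm (I := 𝓡 m) (x := x)
  rw [ModelWithCorners.range_eq_univ, mfderivWithin_univ] at h
  refine (chartMetric_apply m x _ v w).trans ?_
  rw [h, extChartAt_to_inv]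
  rfl

/-- Near the base point, the derivative of the inverse chart is the inverse of the tangent bundle
trivialisation, so `chartMetric` is the local expression of the smooth metric section. -/
theorem contDiffAt_chartMetric [IsManifold (𝓡 m) ∞ M]
    [IsContMDiffRiemannianBundle (𝓡 m) ∞ (EuclideanSpace ℝ (Fin m))
      (fun x : M ↦ TangentSpace (𝓡 m) x)] (x : M) :
    ContDiffAt ℝ ∞ (chartMetric m x) (extChartAt (𝓡 m) x x) := by
  have : IsManifold (𝓡 m) 1 M := IsManifold.of_le (n := ∞) (by simp)
  obtain ⟨g, hg, hgi⟩ := IsContMDiffRiemannianBundle.exists_contMDiff (IB := 𝓡 m) (n := ∞)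
    (F := EuclideanSpace ℝ (Fin m)) (E := fun x : M ↦ TangentSpace (𝓡 m) x)
  have h1 := hg.contMDiffAt (x := x)
  simp only [contMDiffAt_hom_bundle] at h1
  have h2 : ContMDiffAt 𝓘(ℝ, EuclideanSpace ℝ (Fin m)) (𝓡 m) ∞ (extChartAt (𝓡 m) x).symm
      (extChartAt (𝓡 m) x x) :=
    (contMDiffOn_extChartAt_symm x).contMDiffAt (extChartAt_target_mem_nhds x)
  have h3 := h1.2
  rw [← extChartAt_to_inv (I := 𝓡 m) x] at h3
  have h4 := (ContMDiffAt.comp _ h3 h2).contDiffAt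
  refine h4.congr_of_eventuallyEq ?_
  filter_upwards [extChartAt_target_mem_nhds (I := 𝓡 m) x] with u hu
  have hs : (extChartAt (𝓡 m) x).symm u ∈ (chartAt (EuclideanSpace ℝ (Fin m)) x).source := by
    simpa using (extChartAt (𝓡 m) x).map_target hu
  ext v w
  rw [extChartAt_to_inv]
  have hb : (extChartAt (𝓡 m) x).symm u ∈ (trivializationAt (EuclideanSpace ℝ (Fin m))
    (fun x : M ↦ TangentSpace (𝓡 m) x) x).baseSet := hs
  rw [Function.comp_apply, inCoordinates_apply_eq₂ hb hb (Set.mem_univ _)]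
  have hsymm := TangentBundle.symmL_trivializationAt (I := 𝓡 m) (𝕜 := ℝ) hs
  rw [ModelWithCorners.range_eq_univ, mfderivWithin_univ, PartialEquiv.right_inv _ hu] at hsymm
  have hv (v : EuclideanSpace ℝ (Fin m)) :
      (mfderiv 𝓘(ℝ, EuclideanSpace ℝ (Fin m)) (𝓡 m) (extChartAt (𝓡 m) x).symm u v :
        EuclideanSpace ℝ (Fin m)) = (trivializationAt (EuclideanSpace ℝ (Fin m))
        (fun x : M ↦ TangentSpace (𝓡 m) x) x).symm ((extChartAt (𝓡 m) x).symm u) v := by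
    rw [← hsymm]
    exact Trivialization.symmL_apply _ hb v
  rw [chartMetric_apply, hv, hv]
  refine (hgi _ _ _).trans ?_
  simp only [Trivial.fiberBundle_trivializationAt', Trivial.linearMapAt_trivialization]
  rfl

theorem isChartMetricAt_chartMetric [IsManifold (𝓡 m) ∞ M]
    [IsContMDiffRiemannianBundle (𝓡 m) ∞ (EuclideanSpace ℝ (Fin m))
      (fun x : M ↦ TangentSpace (𝓡 m) x)] (x : M) :
    IsChartMetricAt (chartMetric m x) (extChartAt (𝓡 m) x x) where
  contDiffAt := (contDiffAt_chartMetric m x).of_le ENat.LEInfty.out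
  symm := chartMetric_symm m x
  isInvertible := by
    set A := chartMetric m x (extChartAt (𝓡 m) x x)
    -- Positive definiteness gives injectivity into the dual, and equality of dimensions gives
    -- invertibility.
    have hinj : Function.Injective A.toLinearMap := by
      rw [injective_iff_map_eq_zero]
      intro v hv
      have h1 : A v v = 0 := by
        have : A v = 0 := hv
        rw [this]; rfl
      have h2 := chartMetric_self m x (v : TangentSpace (𝓡 m) x) (v : TangentSpace (𝓡 m) x)
      exact (inner_self_eq_zero (𝕜 := ℝ) (E := TangentSpace (𝓡 m) x)).1 (h2.symm.trans h1)
    have hdim : Module.finrank ℝ (EuclideanSpace ℝ (Fin m)) =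
        Module.finrank ℝ (EuclideanSpace ℝ (Fin m) →L[ℝ] ℝ) := by
      rw [← (LinearMap.toContinuousLinearMap (𝕜 := ℝ) (E := EuclideanSpace ℝ (Fin m))
        (F' := ℝ)).finrank_eq]
      exact (Subspace.dual_finrank_eq (K := ℝ) (V := EuclideanSpace ℝ (Fin m))).symm
    exact ⟨(LinearEquiv.ofInjectiveOfFinrankEq _ hinj hdim).toContinuousLinearEquiv, by ext; rfl⟩

end ManifoldMetric

/-! ### From immersions of manifolds to immersions in charts -/

section ManifoldImmersion

set_option maxSynthPendingDepth 3
set_option synthInstance.maxHeartbeats 200000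

variable {n k : ℕ}
  {M : Type*} [TopologicalSpace M] [ChartedSpace (EuclideanSpace ℝ (Fin n)) M]
  {N : Type*} [TopologicalSpace N] [ChartedSpace (EuclideanSpace ℝ (Fin k)) N]
  {f : M → N}

theorem writtenInExtChartAt_extChartAt_self (x : M) :
    writtenInExtChartAt (𝓡 n) (𝓡 k) x f (extChartAt (𝓡 n) x x) = extChartAt (𝓡 k) (f x) (f x) := by
  simp [writtenInExtChartAt]

variable [RiemannianBundle (fun x : M ↦ TangentSpace (𝓡 n) x)]
  [RiemannianBundle (fun y : N ↦ TangentSpace (𝓡 k) y)]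

theorem IsIsometricImmersion.fderiv_writtenInExtChartAt (hf : IsIsometricImmersion n k f) (x : M) :
    fderiv ℝ (writtenInExtChartAt (𝓡 n) (𝓡 k) x f) (extChartAt (𝓡 n) x x) =
      mfderiv (𝓡 n) (𝓡 k) f x := by
  let D : EuclideanSpace ℝ (Fin n) →L[ℝ] EuclideanSpace ℝ (Fin k) := mfderiv (𝓡 n) (𝓡 k) f x
  have h : HasFDerivWithinAt (writtenInExtChartAt (𝓡 n) (𝓡 k) x f) D (Set.range (𝓡 n))
      (extChartAt (𝓡 n) x x) :=
    (hf.1.mdifferentiableAt (x := x) (by simp)).hasMFDerivAt.2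
  rw [ModelWithCorners.range_eq_univ] at h
  exact (hasFDerivWithinAt_univ.1 h).fderiv

theorem IsIsometricImmersion.isChartIsometricAt [IsManifold (𝓡 n) ∞ M] [IsManifold (𝓡 k) ∞ N]
    [IsContMDiffRiemannianBundle (𝓡 n) ∞ (EuclideanSpace ℝ (Fin n))
      (fun x : M ↦ TangentSpace (𝓡 n) x)]
    [IsContMDiffRiemannianBundle (𝓡 k) ∞ (EuclideanSpace ℝ (Fin k))
      (fun y : N ↦ TangentSpace (𝓡 k) y)] (hf : IsIsometricImmersion n k f) (x : M) :
    IsChartIsometricAt (chartMetric n x) (chartMetric k (f x))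
      (writtenInExtChartAt (𝓡 n) (𝓡 k) x f) (extChartAt (𝓡 n) x x) where
  source := isChartMetricAt_chartMetric n x
  target := by
    rw [writtenInExtChartAt_extChartAt_self]
    exact isChartMetricAt_chartMetric k (f x)
  contDiffAt := by
    have h := (contMDiffAt_iff.1 (hf.1.contMDiffAt (x := x))).2
    rw [ModelWithCorners.range_eq_univ, contDiffWithinAt_univ] at h
    exact h.of_le ENat.LEInfty.out
  isometric := by
    set φ := writtenInExtChartAt (𝓡 n) (𝓡 k) x f with hφ
    have hn : (extChartAt (𝓡 n) x).symm ⁻¹' (f ⁻¹' (extChartAt (𝓡 k) (f x)).source) ∈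
        𝓝 (extChartAt (𝓡 n) x x) := by
      apply (continuousAt_extChartAt_symm x).preimage_mem_nhds
      rw [extChartAt_to_inv]
      exact hf.1.continuous.continuousAt.preimage_mem_nhds (extChartAt_source_mem_nhds (f x))
    have hev := Filter.inter_mem (extChartAt_target_mem_nhds (I := 𝓡 n) x) hn
    filter_upwards [eventually_mem_nhds_iff.2 hev] with u hu v w
    have hut : u ∈ (extChartAt (𝓡 n) x).target := (mem_of_mem_nhds hu).1
    have hus : f ((extChartAt (𝓡 n) x).symm u) ∈ (extChartAt (𝓡 k) (f x)).source :=
      (mem_of_mem_nhds hu).2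
    have hsymm : MDifferentiableAt 𝓘(ℝ, EuclideanSpace ℝ (Fin n)) (𝓡 n)
        (extChartAt (𝓡 n) x).symm u := by
      have : ContMDiffAt 𝓘(ℝ, EuclideanSpace ℝ (Fin n)) (𝓡 n) ∞ (extChartAt (𝓡 n) x).symm u :=
        (contMDiffOn_extChartAt_symm x).contMDiffAt (extChartAt_target_mem_nhds' hut)
      exact this.mdifferentiableAt (by simp)
    have hsymm' : MDifferentiableAt 𝓘(ℝ, EuclideanSpace ℝ (Fin k)) (𝓡 k)
        (extChartAt (𝓡 k) (f x)).symm (φ u) := by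
      have : ContMDiffAt 𝓘(ℝ, EuclideanSpace ℝ (Fin k)) (𝓡 k) ∞ (extChartAt (𝓡 k) (f x)).symm
          (φ u) :=
        (contMDiffOn_extChartAt_symm (f x)).contMDiffAt
          (extChartAt_target_mem_nhds' ((extChartAt (𝓡 k) (f x)).map_source hus))
      exact this.mdifferentiableAt (by simp)
    have hfd : MDifferentiableAt (𝓡 n) (𝓡 k) f ((extChartAt (𝓡 n) x).symm u) :=
      hf.1.mdifferentiableAt (by simp)
    have hchart : MDifferentiableAt (𝓡 k) 𝓘(ℝ, EuclideanSpace ℝ (Fin k))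
        (extChartAt (𝓡 k) (f x)) (f ((extChartAt (𝓡 n) x).symm u)) := by
      have : ContMDiffAt (𝓡 k) 𝓘(ℝ, EuclideanSpace ℝ (Fin k)) ∞
          (extChartAt (𝓡 k) (f x)) (f ((extChartAt (𝓡 n) x).symm u)) :=
        contMDiffAt_extChartAt' (by simpa using hus)
      exact this.mdifferentiableAt (by simp)
    have hφd : MDifferentiableAt 𝓘(ℝ, EuclideanSpace ℝ (Fin n)) 𝓘(ℝ, EuclideanSpace ℝ (Fin k))
        φ u := hchart.comp u (hfd.comp u hsymm)
    -- Holding near `u` and not merely at `u`, this identity can be differentiated; the chain rule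
    -- then transfers the isometry property of `f` to `φ`.
    have hcomp : (extChartAt (𝓡 k) (f x)).symm ∘ φ =ᶠ[𝓝 u] f ∘ (extChartAt (𝓡 n) x).symm := by
      filter_upwards [hu] with u' hu'
      exact (extChartAt (𝓡 k) (f x)).left_inv hu'.2
    have hpt : (extChartAt (𝓡 k) (f x)).symm (φ u) = f ((extChartAt (𝓡 n) x).symm u) :=
      hcomp.eq_of_nhds
    have hd (v : EuclideanSpace ℝ (Fin n)) :
        (mfderiv 𝓘(ℝ, EuclideanSpace ℝ (Fin k)) (𝓡 k) (extChartAt (𝓡 k) (f x)).symm (φ u)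
          (fderiv ℝ φ u v) : EuclideanSpace ℝ (Fin k)) =
        mfderiv (𝓡 n) (𝓡 k) f ((extChartAt (𝓡 n) x).symm u)
          (mfderiv 𝓘(ℝ, EuclideanSpace ℝ (Fin n)) (𝓡 n) (extChartAt (𝓡 n) x).symm u v) := by
      have h1 := hcomp.mfderiv_eq (I := 𝓘(ℝ, EuclideanSpace ℝ (Fin n))) (I' := 𝓡 k)
      rw [mfderiv_comp u hsymm' hφd, mfderiv_comp u hfd hsymm, mfderiv_eq_fderiv] at h1
      exact congrArg (fun A : EuclideanSpace ℝ (Fin n) →L[ℝ] EuclideanSpace ℝ (Fin k) ↦ A v) h1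
    rw [chartMetric_apply, chartMetric_apply, hd, hd, hpt]
    exact hf.2 _ _ _

end ManifoldImmersion

/-! ### The curvature tensor in constant sectional curvature -/

section ConstantCurvature

set_option maxSynthPendingDepth 3
set_option synthInstance.maxHeartbeats 200000

theorem chartCurvature_add_left {F : Type*} [NormedAddCommGroup F] [NormedSpace ℝ F]
    [CompleteSpace F] {G : F → F →L[ℝ] F →L[ℝ] ℝ} {y : F} (hG : IsChartMetricAt G y)
    (v v' w z : F) :
    chartCurvature G y (v + v') w z = chartCurvature G y v w z + chartCurvature G y v' w z := by
  simp only [chartCurvature_eq hG, map_add, add_apply]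
  abel

theorem chartCurvature_smul_left {F : Type*} [NormedAddCommGroup F] [NormedSpace ℝ F]
    [CompleteSpace F] {G : F → F →L[ℝ] F →L[ℝ] ℝ} {y : F} (hG : IsChartMetricAt G y)
    (a : ℝ) (v w z : F) :
    chartCurvature G y (a • v) w z = a • chartCurvature G y v w z := by
  simp only [chartCurvature_eq hG, map_smul, smul_apply, smul_sub, smul_add]

variable (m : ℕ) {M : Type*} [TopologicalSpace M] [ChartedSpace (EuclideanSpace ℝ (Fin m)) M]
  [RiemannianBundle (fun x : M ↦ TangentSpace (𝓡 m) x)]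

theorem curvatureTensor_swap (x : M) (v w z : TangentSpace (𝓡 m) x) :
    curvatureTensor m x v w z = - curvatureTensor m x w v z :=
  chartCurvature_swap _ _ v w z

variable [IsManifold (𝓡 m) ∞ M]
  [IsContMDiffRiemannianBundle (𝓡 m) ∞ (EuclideanSpace ℝ (Fin m))
    (fun x : M ↦ TangentSpace (𝓡 m) x)]

theorem curvatureTensor_add_left (x : M) (v v' w z : TangentSpace (𝓡 m) x) :
    curvatureTensor m x (v + v') w z = curvatureTensor m x v w z + curvatureTensor m x v' w z :=
  chartCurvature_add_left (isChartMetricAt_chartMetric m x) v v' w z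

theorem curvatureTensor_smul_left (x : M) (a : ℝ) (v w z : TangentSpace (𝓡 m) x) :
    curvatureTensor m x (a • v) w z = a • curvatureTensor m x v w z :=
  chartCurvature_smul_left (isChartMetricAt_chartMetric m x) a v w z

theorem curvatureTensor_bianchi (x : M) (v w z : TangentSpace (𝓡 m) x) :
    curvatureTensor m x v w z + curvatureTensor m x w z v + curvatureTensor m x z v w = 0 :=
  chartCurvature_bianchi (isChartMetricAt_chartMetric m x) v w z

theorem inner_curvatureTensor_skew (x : M) (v w z z' : TangentSpace (𝓡 m) x) :
    ⟪curvatureTensor m x v w z, z'⟫_ℝ = - ⟪curvatureTensor m x v w z', z⟫_ℝ := by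
  have h := chartCurvature_skew (isChartMetricAt_chartMetric m x) v w z z'
  exact (chartMetric_self m x (curvatureTensor m x v w z) z').symm.trans
    (h.trans (congrArg Neg.neg (chartMetric_self m x (curvatureTensor m x v w z') z)))

/-- The curvature tensor of a manifold of constant sectional curvature. -/
theorem HasConstantSectionalCurvature.inner_curvatureTensor {c : ℝ}
    (h : HasConstantSectionalCurvature m M c) (x : M) (v w z z' : TangentSpace (𝓡 m) x) :
    ⟪curvatureTensor m x v w z, z'⟫_ℝ =
      c * (⟪w, z⟫_ℝ * ⟪v, z'⟫_ℝ - ⟪v, z⟫_ℝ * ⟪w, z'⟫_ℝ) := by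
  rw [← sub_eq_zero]
  -- The model tensor has the same symmetries and sectional curvatures as `R`, so their difference
  -- is curvature-like with vanishing sectional curvatures.
  refine curvatureLike_eq_zero (fun v w z z' : TangentSpace (𝓡 m) x ↦
    ⟪curvatureTensor m x v w z, z'⟫_ℝ - c * (⟪w, z⟫_ℝ * ⟪v, z'⟫_ℝ - ⟪v, z⟫_ℝ * ⟪w, z'⟫_ℝ))
    ?_ ?_ ?_ ?_ ?_ v w z z'
  · intro v v' w z z'
    simp only [curvatureTensor_add_left, inner_add_left]
    ring
  · intro v w z z'
    rw [curvatureTensor_swap m x v w z, inner_neg_left]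
    ring
  · intro v w z z'
    rw [inner_curvatureTensor_skew]
    ring
  · intro v w z z'
    have hb := congrArg (fun a ↦ ⟪a, z'⟫_ℝ) (curvatureTensor_bianchi m x v w z)
    simp only [inner_add_left, inner_zero_left] at hb
    rw [real_inner_comm v z, real_inner_comm w v, real_inner_comm z w]
    linear_combination hb
  · intro v w
    by_cases hvw : LinearIndependent ℝ ![v, w]
    · have hK := h x v w hvw
      have hne : ‖v‖ ^ 2 * ‖w‖ ^ 2 - ⟪v, w⟫_ℝ ^ 2 ≠ 0 := by
        intro h0
        have h1 : |⟪v, w⟫_ℝ| = ‖v‖ * ‖w‖ := by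
          rw [← abs_of_nonneg (mul_nonneg (norm_nonneg v) (norm_nonneg w)),
            ← sq_eq_sq_iff_abs_eq_abs]
          linarith
        have hv : v ≠ 0 := by
          simpa using hvw.ne_zero 0
        have h2 := norm_inner_eq_norm_tfae ℝ v w
        have h3 : w = (⟪v, w⟫_ℝ / ⟪v, v⟫_ℝ) • v := by
          have := (h2.out 0 1).1 h1
          exact this.resolve_left hv
        have h4 := (LinearIndependent.pair_iff.1 hvw) (⟪v, w⟫_ℝ / ⟪v, v⟫_ℝ) (-1) (by
          rw [← h3]; simp)
        norm_num at h4
      rw [sectionalCurvature, div_eq_iff hne] at hK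
      rw [hK, real_inner_self_eq_norm_sq, real_inner_self_eq_norm_sq, real_inner_comm v w]
      ring
    · rw [LinearIndependent.pair_iff] at hvw
      push Not at hvw
      obtain ⟨s, t, hst, hne⟩ := hvw
      have hself (v z : TangentSpace (𝓡 m) x) : curvatureTensor m x v v z = 0 :=
        sub_self (G := EuclideanSpace ℝ (Fin m)) _
      by_cases hs : s = 0
      · have hw : w = 0 := by
          rw [hs, zero_smul, zero_add] at hst
          exact (smul_eq_zero.1 hst).resolve_left (hne hs)
        have h0 := curvatureTensor_smul_left m x 0 w v w
        rw [zero_smul, zero_smul] at h0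
        rw [curvatureTensor_swap, hw]
        rw [hw] at h0
        simp [h0]
      · have hv : v = (-(t / s)) • w := by
          have : s • v = -(t • w) := eq_neg_of_add_eq_zero_left hst
          rw [neg_smul, div_eq_inv_mul, mul_smul, ← smul_neg, ← this, inv_smul_smul₀ hs]
        rw [hv, curvatureTensor_smul_left, hself]
        simp only [smul_zero, inner_zero_left, inner_smul_left, inner_smul_right, conj_trivial]
        ring

end ConstantCurvature

/-! ### Gauss equation and scalar curvature of the submanifold -/

section Immersion

set_option maxSynthPendingDepth 3
set_option synthInstance.maxHeartbeats 200000

theorem two_mul_sum_lt {d : ℕ} (a b : Fin d → Fin d → ℝ) (hs : ∀ i j, b i j = b j i)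
    (h0 : ∀ i, b i i = 0) (hab : ∀ i j, i ≠ j → a i j = b i j) :
    2 * (∑ i, ∑ j, if i < j then a i j else 0) = ∑ i, ∑ j, b i j := by
  have h1 : ∑ i, ∑ j, (if i < j then a i j else 0) = ∑ i, ∑ j, (if i < j then b i j else 0) :=
    Finset.sum_congr rfl fun i _ ↦ Finset.sum_congr rfl fun j _ ↦ by
      split_ifs with h
      · exact hab i j h.ne
      · rfl
  have h2 : ∑ i, ∑ j, (if i < j then b i j else 0) = ∑ i, ∑ j, (if j < i then b i j else 0) := by
    rw [Finset.sum_comm]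
    simp only [hs]
  rw [h1, two_mul]
  conv_lhs => rw [h2]
  conv_lhs => enter [1]; rw [← h2]
  rw [← Finset.sum_add_distrib]
  refine Finset.sum_congr rfl fun i _ ↦ ?_
  rw [← Finset.sum_add_distrib]
  refine Finset.sum_congr rfl fun j _ ↦ ?_
  rcases lt_trichotomy i j with h | rfl | h
  · simp [h, h.not_gt]
  · simp [h0]
  · simp [h, h.not_gt]

variable {n k : ℕ}
  {M : Type*} [TopologicalSpace M] [ChartedSpace (EuclideanSpace ℝ (Fin n)) M]
  {N : Type*} [TopologicalSpace N] [ChartedSpace (EuclideanSpace ℝ (Fin k)) N]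
  [IsManifold (𝓡 k) ∞ N]
  [RiemannianBundle (fun y : N ↦ TangentSpace (𝓡 k) y)]

theorem chartMetric_target_eq (f : M → N) (x : M) (a b : TangentSpace (𝓡 k) (f x)) :
    chartMetric k (f x) (writtenInExtChartAt (𝓡 n) (𝓡 k) x f (extChartAt (𝓡 n) x x)) a b =
      ⟪a, b⟫_ℝ := by
  refine Eq.trans ?_ (chartMetric_self k (f x) a b)
  rw [writtenInExtChartAt_extChartAt_self]

variable [IsManifold (𝓡 n) ∞ M]
  [RiemannianBundle (fun x : M ↦ TangentSpace (𝓡 n) x)]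
  [IsContMDiffRiemannianBundle (𝓡 n) ∞ (EuclideanSpace ℝ (Fin n))
    (fun x : M ↦ TangentSpace (𝓡 n) x)]
  [IsContMDiffRiemannianBundle (𝓡 k) ∞ (EuclideanSpace ℝ (Fin k))
    (fun y : N ↦ TangentSpace (𝓡 k) y)]
  {f : M → N}

theorem IsIsometricImmersion.secondFundamentalForm_symm (hf : IsIsometricImmersion n k f) (x : M)
    (v w : TangentSpace (𝓡 n) x) :
    secondFundamentalForm n k f x v w = secondFundamentalForm n k f x w v :=
  (hf.isChartIsometricAt x).secondFundamentalForm_symm v w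

/-- The second fundamental form as a bilinear map. -/
def IsIsometricImmersion.secondFundamentalFormₗ (hf : IsIsometricImmersion n k f) (x : M) :
    TangentSpace (𝓡 n) x →ₗ[ℝ] TangentSpace (𝓡 n) x →ₗ[ℝ] TangentSpace (𝓡 k) (f x) :=
  LinearMap.mk₂ ℝ (secondFundamentalForm n k f x)
    (fun v v' w ↦ chartSecondFundamentalForm_add_left (E := EuclideanSpace ℝ (Fin n))
      (F := EuclideanSpace ℝ (Fin k)) _ _ _ _ v v' w)
    (fun a v w ↦ chartSecondFundamentalForm_smul_left (E := EuclideanSpace ℝ (Fin n))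
      (F := EuclideanSpace ℝ (Fin k)) _ _ _ a _ v w)
    (fun v w w' ↦ by
      rw [hf.secondFundamentalForm_symm, hf.secondFundamentalForm_symm x v w,
        hf.secondFundamentalForm_symm x v w']
      exact chartSecondFundamentalForm_add_left (E := EuclideanSpace ℝ (Fin n))
        (F := EuclideanSpace ℝ (Fin k)) _ _ _ _ w w' v)
    (fun a v w ↦ by
      rw [hf.secondFundamentalForm_symm, hf.secondFundamentalForm_symm x v w]
      exact chartSecondFundamentalForm_smul_left (E := EuclideanSpace ℝ (Fin n))
        (F := EuclideanSpace ℝ (Fin k)) _ _ _ a _ w v)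

theorem IsIsometricImmersion.secondFundamentalFormₗ_apply (hf : IsIsometricImmersion n k f) (x : M)
    (v w : TangentSpace (𝓡 n) x) :
    hf.secondFundamentalFormₗ x v w = secondFundamentalForm n k f x v w := rfl

theorem IsIsometricImmersion.secondFundamentalForm_mem_normalSpace
    (hf : IsIsometricImmersion n k f) (x : M) (v w : TangentSpace (𝓡 n) x) :
    secondFundamentalForm n k f x v w ∈ normalSpace n k f x := by
  rw [normalSpace, Submodule.mem_orthogonal']
  rintro _ ⟨z, rfl⟩
  have h := (hf.isChartIsometricAt x).metric_secondFundamentalForm_fderiv v w z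
  rw [hf.fderiv_writtenInExtChartAt x] at h
  exact (chartMetric_target_eq f x _ _).symm.trans h

/-- The Gauss equation in a space of constant curvature. -/
theorem IsIsometricImmersion.inner_curvatureTensor {c : ℝ}
    (hN : HasConstantSectionalCurvature k N c) (hf : IsIsometricImmersion n k f) (x : M)
    (v w z z' : TangentSpace (𝓡 n) x) :
    ⟪curvatureTensor n x v w z, z'⟫_ℝ =
      c * (⟪w, z⟫_ℝ * ⟪v, z'⟫_ℝ - ⟪v, z⟫_ℝ * ⟪w, z'⟫_ℝ)
      + ⟪secondFundamentalForm n k f x w z, secondFundamentalForm n k f x v z'⟫_ℝ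
      - ⟪secondFundamentalForm n k f x v z, secondFundamentalForm n k f x w z'⟫_ℝ := by
  have h := (hf.isChartIsometricAt x).gauss v w z z'
  rw [hf.fderiv_writtenInExtChartAt x] at h
  have h1 := hN.inner_curvatureTensor k (f x) (mfderiv (𝓡 n) (𝓡 k) f x v)
    (mfderiv (𝓡 n) (𝓡 k) f x w) (mfderiv (𝓡 n) (𝓡 k) f x z) (mfderiv (𝓡 n) (𝓡 k) f x z')
  rw [hf.2, hf.2, hf.2, hf.2] at h1
  rw [← h1]
  refine (chartMetric_self n x _ _).symm.trans (h.trans ?_)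
  refine congrArg₂ (· - ·) (congrArg₂ (· + ·) ?_ (chartMetric_target_eq f x _ _))
    (chartMetric_target_eq f x _ _)
  rw [writtenInExtChartAt_extChartAt_self]
  exact chartMetric_self k (f x) _ _

theorem IsIsometricImmersion.sectionalCurvature_eq {c : ℝ}
    (hN : HasConstantSectionalCurvature k N c) (hf : IsIsometricImmersion n k f) (x : M)
    {v w : TangentSpace (𝓡 n) x} (hv : ‖v‖ = 1) (hw : ‖w‖ = 1) (hvw : ⟪v, w⟫_ℝ = 0) :
    sectionalCurvature n x v w =
      c + ⟪secondFundamentalForm n k f x v v, secondFundamentalForm n k f x w w⟫_ℝ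
        - ‖secondFundamentalForm n k f x v w‖ ^ 2 := by
  rw [sectionalCurvature, hf.inner_curvatureTensor hN, real_inner_self_eq_norm_sq,
    real_inner_self_eq_norm_sq, hv, hw, hvw, hf.secondFundamentalForm_symm x w v,
    real_inner_self_eq_norm_sq, real_inner_comm (secondFundamentalForm n k f x v v)]
  ring

theorem IsIsometricImmersion.two_mul_scalarCurvature {c : ℝ}
    (hN : HasConstantSectionalCurvature k N c) (hf : IsIsometricImmersion n k f) (x : M) :
    2 * scalarCurvature n x = n * (n - 1) * c
      + (‖∑ i, secondFundamentalForm n k f x (stdOrthonormalBasis ℝ (TangentSpace (𝓡 n) x) i)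
        (stdOrthonormalBasis ℝ (TangentSpace (𝓡 n) x) i)‖ ^ 2
      - ∑ i, ∑ j, ‖secondFundamentalForm n k f x (stdOrthonormalBasis ℝ (TangentSpace (𝓡 n) x) i)
        (stdOrthonormalBasis ℝ (TangentSpace (𝓡 n) x) j)‖ ^ 2) := by
  have hd : Module.finrank ℝ (TangentSpace (𝓡 n) x) = n :=
    finrank_euclideanSpace_fin (𝕜 := ℝ) (n := n)
  set e := stdOrthonormalBasis ℝ (TangentSpace (𝓡 n) x) with he
  set h := secondFundamentalForm n k f x
  have h1 := two_mul_sum_lt (fun i j ↦ sectionalCurvature n x (e i) (e j))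
    -- This expression agrees with the sectional curvature off the diagonal and vanishes on it, so
    -- the sum over `i < j` can be completed to the full double sum, whose products factor into
    -- `‖H‖²`.
    (fun i j ↦ c * (1 - if i = j then 1 else 0) + (⟪h (e i) (e i), h (e j) (e j)⟫_ℝ
      - ‖h (e i) (e j)‖ ^ 2)) ?_ ?_ ?_
  · rw [scalarCurvature]
    refine h1.trans ?_
    simp only [Finset.sum_add_distrib, Finset.sum_sub_distrib, ← Finset.mul_sum, ← inner_sum,
      ← sum_inner, real_inner_self_eq_norm_sq]
    simp [hd]
    ring
  · intro i j
    simp only [real_inner_comm, hf.secondFundamentalForm_symm x (e i) (e j), eq_comm, h]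
  · intro i
    simp
  · intro i j hij
    rw [hf.sectionalCurvature_eq hN x (e.orthonormal.1 i) (e.orthonormal.1 j)
      (e.orthonormal.2 hij), if_neg hij]
    ring

end Immersion

/-! ### Normal spaces, shape operators and flatness of the normal connection -/

section EqualityCase

set_option maxSynthPendingDepth 3
set_option synthInstance.maxHeartbeats 200000

variable {n k : ℕ}
  {M : Type*} [TopologicalSpace M] [ChartedSpace (EuclideanSpace ℝ (Fin n)) M]
  [RiemannianBundle (fun x : M ↦ TangentSpace (𝓡 n) x)]
  {N : Type*} [TopologicalSpace N] [ChartedSpace (EuclideanSpace ℝ (Fin k)) N]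
  [RiemannianBundle (fun y : N ↦ TangentSpace (𝓡 k) y)]
  {f : M → N}

theorem IsIsometricImmersion.finrank_normalSpace (hf : IsIsometricImmersion n k f) (x : M) :
    n + Module.finrank ℝ (normalSpace n k f x) = k := by
  have hinj : Function.Injective
      (mfderiv (𝓡 n) (𝓡 k) f x : TangentSpace (𝓡 n) x →ₗ[ℝ] TangentSpace (𝓡 k) (f x)) := by
    rw [injective_iff_map_eq_zero]
    intro v hv
    have h1 := hf.2 x v v
    have h2 : mfderiv (𝓡 n) (𝓡 k) f x v = 0 := hv
    rw [h2, inner_zero_left] at h1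
    exact inner_self_eq_zero.1 h1.symm
  have h1 := LinearMap.finrank_range_of_inj hinj
  have h2 := (LinearMap.range (mfderiv (𝓡 n) (𝓡 k) f x :
    TangentSpace (𝓡 n) x →ₗ[ℝ] TangentSpace (𝓡 k) (f x))).finrank_add_finrank_orthogonal
  have h3 : Module.finrank ℝ (TangentSpace (𝓡 n) x) = n :=
    finrank_euclideanSpace_fin (𝕜 := ℝ) (n := n)
  have h4 : Module.finrank ℝ (TangentSpace (𝓡 k) (f x)) = k :=
    finrank_euclideanSpace_fin (𝕜 := ℝ) (n := k)
  rw [h1, h3, h4] at h2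
  exact h2

variable [IsManifold (𝓡 n) ∞ M]
  [IsContMDiffRiemannianBundle (𝓡 n) ∞ (EuclideanSpace ℝ (Fin n))
    (fun x : M ↦ TangentSpace (𝓡 n) x)]
  [IsManifold (𝓡 k) ∞ N]
  [IsContMDiffRiemannianBundle (𝓡 k) ∞ (EuclideanSpace ℝ (Fin k))
    (fun y : N ↦ TangentSpace (𝓡 k) y)]

/-- In a space of constant curvature, a second fundamental form that is diagonal with values on a
line has a flat normal connection. -/
theorem IsIsometricImmersion.hasTrivialNormalConnectionAt_of_diagonal {c : ℝ}
    (hN : HasConstantSectionalCurvature k N c) (hf : IsIsometricImmersion n k f) (x : M)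
    {ι : Type*} [Fintype ι] [DecidableEq ι] (e : OrthonormalBasis ι ℝ (TangentSpace (𝓡 n) x))
    (μ : ι → ℝ) (Λ : TangentSpace (𝓡 k) (f x))
    (hΛ : ∀ i j, secondFundamentalForm n k f x (e i) (e j) = if i = j then μ i • Λ else 0) :
    HasTrivialNormalConnectionAt n k f x := by
  intro ξ hξ hn v w
  set φ := writtenInExtChartAt (𝓡 n) (𝓡 k) x f
  set u := extChartAt (𝓡 n) x x
  have hI : IsChartIsometricAt (chartMetric n x) (chartMetric k (f x)) φ u :=
    hf.isChartIsometricAt x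
  have hξ2 : ContDiffAt ℝ 2 ξ u := hξ.of_le ENat.LEInfty.out
  have hT (v z : EuclideanSpace ℝ (Fin n)) := hI.metric_tangentialDeriv
    (hξ2.differentiableAt (by norm_num)) hn v z
  have hcomm : chartSecondFundamentalForm (chartMetric n x) (chartMetric k (f x)) φ u v
        (chartTangentialDeriv (chartMetric n x) (chartMetric k (f x)) φ ξ w u) =
      chartSecondFundamentalForm (chartMetric n x) (chartMetric k (f x)) φ u w
        (chartTangentialDeriv (chartMetric n x) (chartMetric k (f x)) φ ξ v u) := by
    refine apply_comm_of_diagonal (hf.secondFundamentalFormₗ x) e μ Λ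
      (ξ u : TangentSpace (𝓡 k) (f x)) hΛ (v := v) (w := w) ?_ ?_
    · intro z
      exact (chartMetric_self n x _ _).symm.trans ((hT v z).trans
        (congrArg Neg.neg (chartMetric_target_eq f x _ _)))
    · intro z
      exact (chartMetric_self n x _ _).symm.trans ((hT w z).trans
        (congrArg Neg.neg (chartMetric_target_eq f x _ _)))
  -- In constant curvature, each term of `⟪R̄(X, Y)ξ, η⟫` contains the inner product of `η` with `X`
  -- or `Y`, which are tangent here.
  have hcurv (η : EuclideanSpace ℝ (Fin k))
      (hη : ∀ z, chartMetric k (f x) (φ u) (fderiv ℝ φ u z) η = 0) :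
      chartMetric k (f x) (φ u) (chartCurvature (chartMetric k (f x)) (φ u) (fderiv ℝ φ u v)
        (fderiv ℝ φ u w) (ξ u)) η = 0 := by
    have h1 := hN.inner_curvatureTensor k (f x) (fderiv ℝ φ u v) (fderiv ℝ φ u w) (ξ u) η
    have h2 (z : EuclideanSpace ℝ (Fin n)) :
        inner ℝ (E := TangentSpace (𝓡 k) (f x)) (fderiv ℝ φ u z) η = 0 :=
      (chartMetric_target_eq f x _ _).symm.trans (hη z)
    have h3 : φ u = extChartAt (𝓡 k) (f x) (f x) := writtenInExtChartAt_extChartAt_self x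
    rw [h2, h2] at h1
    rw [h3]
    exact (chartMetric_self k (f x) _ _).trans (h1.trans (by ring))
  -- Test against an arbitrary vector. Its tangential part is invisible to the normal-valued `R^⊥`,
  -- and the Ricci equation handles its normal part.
  apply hI.target.ext
  intro η₀
  rw [map_zero, zero_apply]
  set η := chartNormalPart (chartMetric n x) (chartMetric k (f x)) φ u η₀ with hη
  have hηn (z : EuclideanSpace ℝ (Fin n)) :
      chartMetric k (f x) (φ u) (fderiv ℝ φ u z) η = 0 := by
    rw [hI.target.symm]
    exact hI.metric_normalPart_fderiv η₀ z
  have hdecomp : η₀ = η + fderiv ℝ φ u ((chartMetric n x u).inverse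
      ((chartMetric k (f x) (φ u) η₀) ∘L fderiv ℝ φ u)) := by
    rw [hη, chartNormalPart, sub_add_cancel]
  rw [hdecomp, map_add, hI.metric_normalCurvature_fderiv, add_zero, hI.ricci hξ2 v w hηn,
    hcurv η hηn, hcomm]
  ring

theorem IsIsometricImmersion.inner_shapeOperator (hf : IsIsometricImmersion n k f) (x : M)
    (ξ : TangentSpace (𝓡 k) (f x)) (v w : TangentSpace (𝓡 n) x) :
    ⟪shapeOperator n k f x ξ v, w⟫_ℝ = ⟪secondFundamentalForm n k f x v w, ξ⟫_ℝ := by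
  set e := stdOrthonormalBasis ℝ (TangentSpace (𝓡 n) x) with he
  have h1 : shapeOperator n k f x ξ v = ∑ i, ⟪secondFundamentalForm n k f x v (e i), ξ⟫_ℝ • e i :=
    rfl
  rw [h1, ← hf.secondFundamentalFormₗ_apply x v w]
  conv_rhs => rw [← e.sum_repr' w, map_sum, sum_inner]
  rw [sum_inner]
  refine Finset.sum_congr rfl fun i _ ↦ ?_
  rw [map_smul, inner_smul_left, inner_smul_left, conj_trivial, conj_trivial,
    hf.secondFundamentalFormₗ_apply, mul_comm]

theorem IsIsometricImmersion.toMatrix_shapeOperator (hf : IsIsometricImmersion n k f) (x : M)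
    {ι : Type*} [Fintype ι] [DecidableEq ι] (e : OrthonormalBasis ι ℝ (TangentSpace (𝓡 n) x))
    (ξ : TangentSpace (𝓡 k) (f x)) (i j : ι) :
    LinearMap.toMatrix e.toBasis e.toBasis (shapeOperator n k f x ξ) i j =
      ⟪secondFundamentalForm n k f x (e i) (e j), ξ⟫_ℝ := by
  rw [LinearMap.toMatrix_apply, OrthonormalBasis.coe_toBasis, e.coe_toBasis_repr_apply,
    e.repr_apply_apply, real_inner_comm, hf.inner_shapeOperator, hf.secondFundamentalForm_symm]

end EqualityCase

/-! ### The inequality on the manifold and the shape of the equality case -/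

section Main

set_option maxSynthPendingDepth 3
set_option synthInstance.maxHeartbeats 200000

variable {l k : ℕ}
  {M : Type*} [TopologicalSpace M] [ChartedSpace (EuclideanSpace ℝ (Fin (l + 1))) M]
  [RiemannianBundle (fun x : M ↦ TangentSpace (𝓡 (l + 1)) x)]
  {N : Type*} [TopologicalSpace N] [ChartedSpace (EuclideanSpace ℝ (Fin k)) N]
  [RiemannianBundle (fun y : N ↦ TangentSpace (𝓡 k) y)]
  {f : M → N}

theorem isInvariantlyQuasiUmbilicalAt_of_toMatrix (x : M) {p : ℕ}
    (e : OrthonormalBasis (Fin (l + 1)) ℝ (TangentSpace (𝓡 (l + 1)) x))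
    (ξ : OrthonormalBasis (Fin p) ℝ (normalSpace (l + 1) k f x)) (a : ℝ)
    (h : ∀ r : Fin p, LinearMap.toMatrix e.toBasis e.toBasis
        (shapeOperator (l + 1) k f x (ξ r : TangentSpace (𝓡 k) (f x))) =
      if (r : ℕ) = 0 then
        Matrix.diagonal (fun i : Fin (l + 1) ↦ if (i : ℕ) + 1 = l + 1 then 2 * a else a)
      else 0) :
    IsInvariantlyQuasiUmbilicalAt (l + 1) k p f x := by
  refine ⟨ξ, e (Fin.last l), e.orthonormal.1 _, fun r ↦ ?_⟩
  by_cases hr : (r : ℕ) = 0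
  · exact ⟨a, 2 * a, quasiUmbilical_of_toMatrix_eq_diagonal _ e a (2 * a)
      ((h r).trans (if_pos hr))⟩
  · refine ⟨0, 0, quasiUmbilical_of_toMatrix_eq_diagonal _ e 0 0 ((h r).trans ?_)⟩
    rw [if_neg hr]
    simp

variable [IsManifold (𝓡 (l + 1)) ∞ M]
  [IsContMDiffRiemannianBundle (𝓡 (l + 1)) ∞ (EuclideanSpace ℝ (Fin (l + 1)))
    (fun x : M ↦ TangentSpace (𝓡 (l + 1)) x)]
  [IsManifold (𝓡 k) ∞ N]
  [IsContMDiffRiemannianBundle (𝓡 k) ∞ (EuclideanSpace ℝ (Fin k))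
    (fun y : N ↦ TangentSpace (𝓡 k) y)]

/-- Gauss expresses `ρ - c` through `‖H‖²` and `S`, which reduces everything to
`casorati_inequality` for the second fundamental form. -/
theorem IsIsometricImmersion.normalizedScalarCurvature_le {c : ℝ} (hl : 1 ≤ l)
    (hN : HasConstantSectionalCurvature k N c) (hf : IsIsometricImmersion (l + 1) k f) (x : M) :
    normalizedScalarCurvature (l + 1) x ≤ deltaCasorati (l + 1) k f x + c ∧
    (normalizedScalarCurvature (l + 1) x = deltaCasorati (l + 1) k f x + c ↔
      ∃ (b : OrthonormalBasis (Fin (l + 1)) ℝ (TangentSpace (𝓡 (l + 1)) x))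
        (Λ : TangentSpace (𝓡 k) (f x)), ∀ i j, secondFundamentalForm (l + 1) k f x (b i) (b j) =
        if i = j then (if i = Fin.last l then (2 : ℝ) else 1) • Λ else 0) := by
  have hd : Module.finrank ℝ (TangentSpace (𝓡 (l + 1)) x) = l + 1 :=
    finrank_euclideanSpace_fin (𝕜 := ℝ) (n := l + 1)
  have key := casorati_inequality hl hd (hf.secondFundamentalFormₗ x)
    (hf.secondFundamentalForm_symm x) (stdOrthonormalBasis ℝ (TangentSpace (𝓡 (l + 1)) x)) rfl rfl
  have hl0 : (0 : ℝ) < l := by exact_mod_cast hl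
  have h1 : normalizedScalarCurvature (l + 1) x - c =
      (‖∑ i, hf.secondFundamentalFormₗ x (stdOrthonormalBasis ℝ (TangentSpace (𝓡 (l + 1)) x) i)
        (stdOrthonormalBasis ℝ (TangentSpace (𝓡 (l + 1)) x) i)‖ ^ 2
      - ∑ i, ∑ j, ‖hf.secondFundamentalFormₗ x
        (stdOrthonormalBasis ℝ (TangentSpace (𝓡 (l + 1)) x) i)
        (stdOrthonormalBasis ℝ (TangentSpace (𝓡 (l + 1)) x) j)‖ ^ 2) / (((l : ℝ) + 1) * l) := by
    rw [normalizedScalarCurvature, hf.two_mul_scalarCurvature hN]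
    simp only [hf.secondFundamentalFormₗ_apply]
    push_cast
    rw [add_sub_cancel_right]
    field_simp
    ring
  have h2 : deltaCasorati (l + 1) k f x = 1 / 2 * (1 / ((l : ℝ) + 1) *
      ∑ i, ∑ j, ‖hf.secondFundamentalFormₗ x
        (stdOrthonormalBasis ℝ (TangentSpace (𝓡 (l + 1)) x) i)
        (stdOrthonormalBasis ℝ (TangentSpace (𝓡 (l + 1)) x) j)‖ ^ 2)
      + ((l : ℝ) + 2) / (2 * ((l : ℝ) + 1)) *
      sInf {c : ℝ | ∃ L : Submodule ℝ (TangentSpace (𝓡 (l + 1)) x),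
        Module.finrank ℝ L + 1 = l + 1 ∧
        c = 1 / (Module.finrank ℝ L : ℝ) * restrictNormSq (hf.secondFundamentalFormₗ x) L} := by
    have h3 : ((l + 1 : ℕ) : ℝ) = (l : ℝ) + 1 := by push_cast; ring
    have h4 : (l : ℝ) + 2 = (l : ℝ) + 1 + 1 := by ring
    rw [deltaCasorati, casoratiCurvature, h3, h4]
    rfl
  rw [← h1, ← h2] at key
  rw [← sub_le_iff_le_add, ← sub_eq_iff_eq_add]
  exact key

theorem IsIsometricImmersion.toMatrix_shapeOperator_eq_iff (hf : IsIsometricImmersion (l + 1) k f)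
    (x : M) {p : ℕ} (e : OrthonormalBasis (Fin (l + 1)) ℝ (TangentSpace (𝓡 (l + 1)) x))
    (ξ : OrthonormalBasis (Fin p) ℝ (normalSpace (l + 1) k f x)) (a : ℝ) (r : Fin p) :
    (LinearMap.toMatrix e.toBasis e.toBasis
        (shapeOperator (l + 1) k f x (ξ r : TangentSpace (𝓡 k) (f x))) =
      if (r : ℕ) = 0 then
        Matrix.diagonal (fun i : Fin (l + 1) ↦ if (i : ℕ) + 1 = l + 1 then 2 * a else a)
      else 0) ↔
    ∀ i j, ⟪secondFundamentalForm (l + 1) k f x (e i) (e j), (ξ r : TangentSpace (𝓡 k) (f x))⟫_ℝ =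
      if i = j then (if i = Fin.last l then (2 : ℝ) else 1) * (if (r : ℕ) = 0 then a else 0)
      else 0 := by
  rw [← Matrix.ext_iff]
  refine forall_congr' fun i ↦ forall_congr' fun j ↦ ?_
  rw [hf.toMatrix_shapeOperator]
  have : (if (r : ℕ) = 0 then
        Matrix.diagonal (fun i : Fin (l + 1) ↦ if (i : ℕ) + 1 = l + 1 then 2 * a else a)
      else 0) i j = if i = j then (if i = Fin.last l then (2 : ℝ) else 1) *
        (if (r : ℕ) = 0 then a else 0) else 0 := by
    have hi : (i : ℕ) = l ↔ i = Fin.last l := by rw [Fin.ext_iff, Fin.val_last]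
    by_cases hr : (r : ℕ) = 0 <;> by_cases hij : i = j <;> by_cases hil : i = Fin.last l <;>
      simp_all
  rw [this]

/-- Shape operator matrices are the components of `h` in the normal frame. That only the first is
nonzero means that `h` takes values on one line, and the frame can be rotated so that its first
vector spans it. -/
theorem IsIsometricImmersion.exists_toMatrix_shapeOperator_iff
    (hf : IsIsometricImmersion (l + 1) k f) (x : M) {p : ℕ} (hp : l + 1 + p = k)
    (e : OrthonormalBasis (Fin (l + 1)) ℝ (TangentSpace (𝓡 (l + 1)) x)) :
    (∃ (ξ : OrthonormalBasis (Fin p) ℝ (normalSpace (l + 1) k f x)) (a : ℝ), ∀ r : Fin p,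
      LinearMap.toMatrix e.toBasis e.toBasis
        (shapeOperator (l + 1) k f x (ξ r : TangentSpace (𝓡 k) (f x))) =
      if (r : ℕ) = 0 then
        Matrix.diagonal (fun i : Fin (l + 1) ↦ if (i : ℕ) + 1 = l + 1 then 2 * a else a)
      else 0) ↔
    ∃ Λ : TangentSpace (𝓡 k) (f x), ∀ i j, secondFundamentalForm (l + 1) k f x (e i) (e j) =
      if i = j then (if i = Fin.last l then (2 : ℝ) else 1) • Λ else 0 := by
  simp only [hf.toMatrix_shapeOperator_eq_iff x e]
  constructor
  · rintro ⟨ξ, a, h⟩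
    -- This is `a` times the first frame vector; written as a sum it also makes sense, and is zero,
    -- when `p = 0`.
    let Λ : normalSpace (l + 1) k f x := ∑ r : Fin p, (if (r : ℕ) = 0 then a else 0) • ξ r
    refine ⟨Λ, fun i j ↦ ?_⟩
    have hΛ (r : Fin p) : ⟪Λ, ξ r⟫_ℝ = if (r : ℕ) = 0 then a else 0 := by
      simp only [Λ, sum_inner, inner_smul_left, conj_trivial, ξ.inner_eq_ite, mul_ite, mul_one,
        mul_zero, Finset.sum_ite_eq', Finset.mem_univ, if_true]
    let hij : normalSpace (l + 1) k f x :=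
      ⟨_, hf.secondFundamentalForm_mem_normalSpace x (e i) (e j)⟩
    have h1 : hij = if i = j then (if i = Fin.last l then (2 : ℝ) else 1) • Λ else 0 := by
      apply ξ.repr.injective
      ext r
      rw [ξ.repr_apply_apply, ξ.repr_apply_apply, real_inner_comm, real_inner_comm _ (ξ r)]
      refine (h r i j).trans ?_
      split_ifs <;> simp_all [inner_smul_left]
    have h2 := congrArg (Subtype.val) h1
    refine h2.trans ?_
    split_ifs <;> rfl
  · rintro ⟨Λ, h⟩
    have hΛ : Λ ∈ normalSpace (l + 1) k f x := by
      -- `Λ` is normal because `2 • Λ` is a value of the second fundamental form.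
      have h1 := h (Fin.last l) (Fin.last l)
      simp only [if_true] at h1
      have h2 := (normalSpace (l + 1) k f x).smul_mem (2⁻¹ : ℝ)
        (hf.secondFundamentalForm_mem_normalSpace x (e (Fin.last l)) (e (Fin.last l)))
      rwa [h1, smul_smul, inv_mul_cancel₀ two_ne_zero, one_smul] at h2
    have hrank : Module.finrank ℝ (normalSpace (l + 1) k f x) = p := by
      have := hf.finrank_normalSpace x
      omega
    obtain ⟨ξ, a, hξ⟩ := exists_orthonormalBasis_inner_eq hrank ⟨Λ, hΛ⟩
    refine ⟨ξ, a, fun r i j ↦ ?_⟩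
    have h1 : ⟪Λ, (ξ r : TangentSpace (𝓡 k) (f x))⟫_ℝ = if (r : ℕ) = 0 then a else 0 := hξ r
    rw [h]
    split_ifs <;> simp_all [inner_smul_left]

end Main

end Casorati

end

theorem theorem4p1 (n p : ℕ) (hn : 2 ≤ n) (c : ℝ)
    {M : Type*} [TopologicalSpace M] [ChartedSpace (EuclideanSpace ℝ (Fin n)) M]
    [IsManifold (𝓡 n) ∞ M]
    [RiemannianBundle (fun x : M ↦ TangentSpace (𝓡 n) x)]
    [IsContMDiffRiemannianBundle (𝓡 n) ∞ (EuclideanSpace ℝ (Fin n))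
      (fun x : M ↦ TangentSpace (𝓡 n) x)]
    {N : Type*} [TopologicalSpace N] [ChartedSpace (EuclideanSpace ℝ (Fin (n + p))) N]
    [IsManifold (𝓡 (n + p)) ∞ N]
    [RiemannianBundle (fun y : N ↦ TangentSpace (𝓡 (n + p)) y)]
    [IsContMDiffRiemannianBundle (𝓡 (n + p)) ∞ (EuclideanSpace ℝ (Fin (n + p)))
      (fun y : N ↦ TangentSpace (𝓡 (n + p)) y)]
    (hN : Casorati.HasConstantSectionalCurvature (n + p) N c)
    (f : M → N) (hf : Casorati.IsIsometricImmersion n (n + p) f) (x : M) :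
    Casorati.normalizedScalarCurvature n x
        ≤ Casorati.deltaCasorati n (n + p) f x + c ∧
    (Casorati.normalizedScalarCurvature n x
        = Casorati.deltaCasorati n (n + p) f x + c ↔
      Casorati.IsInvariantlyQuasiUmbilicalAt n (n + p) p f x ∧
      Casorati.HasTrivialNormalConnectionAt n (n + p) f x ∧
      ∃ (e : OrthonormalBasis (Fin n) ℝ (TangentSpace (𝓡 n) x))
        (ξ : OrthonormalBasis (Fin p) ℝ (Casorati.normalSpace n (n + p) f x))
        (l : ℝ), ∀ r : Fin p,
        LinearMap.toMatrix e.toBasis e.toBasis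
            (Casorati.shapeOperator n (n + p) f x
              (ξ r : TangentSpace (𝓡 (n + p)) (f x))) =
          if (r : ℕ) = 0 then
            Matrix.diagonal (fun i : Fin n ↦ if (i : ℕ) + 1 = n then 2 * l else l)
          else 0) := by
  obtain ⟨d, rfl⟩ : ∃ d, n = d + 1 := ⟨n - 1, by omega⟩
  obtain ⟨hle, hiff⟩ := hf.normalizedScalarCurvature_le (by omega) hN x
  refine ⟨hle, hiff.trans ⟨?_, ?_⟩⟩
  · rintro ⟨e, Λ, h⟩
    obtain ⟨ξ, a, hξ⟩ := (hf.exists_toMatrix_shapeOperator_iff x rfl e).2 ⟨Λ, h⟩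
    exact ⟨Casorati.isInvariantlyQuasiUmbilicalAt_of_toMatrix x e ξ a hξ,
      hf.hasTrivialNormalConnectionAt_of_diagonal hN x e _ Λ h, e, ξ, a, hξ⟩
  -- Condition (iii) alone forces equality; (i) and (ii) are consequences of it.
  · rintro ⟨-, -, e, ξ, a, h⟩
    exact ⟨e, (hf.exists_toMatrix_shapeOperator_iff x rfl e).1 ⟨ξ, a, h⟩⟩
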